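/- Let $r,\mu\in\mathbb R$ and $\lambda_0,\sigma,\beta,P>0$, put $\tilde r:=r+\lambda_0$ and assume $\tilde r>0$, $\mu<\tilde r$ and $\mu<\tfrac12\sigma^2$. Let $(B_t)_{t\ge0}$ be a standard Brownian motion and let $\tau_0$ be an exponential random variable with rate $\lambda_0$, independent of $(B_t)$. For $x\ge0$ let $X_t=x\exp\{(\mu-\tfrac12\sigma^2)t+\sigma B_t\}$ be the geometric Brownian motion started at $x$ (with $\mathsf P_x,\mathsf E_x$ the corresponding probability and expectation), and let $\tau_b:=\inf\{t\ge0:X_t\ge b\}\in[0,\infty]$ be its hitting time of $b\in\mathbb R$ (with $\inf\varnothing=\infty$). For $K\in\mathbb R$ put $$\mathrm{eNPV}_K(x;\tau):=\mathsf E_x\bigl[e^{-r\tau}\bigl(e^{-r(\tau_0-\tau)}\beta X_{\tau_0}-K\bigr)\mathbf 1_{\{\tau<\tau_0\}}\bigr],\qquad u_K(x):=\sup_{b\ge0}\mathrm{eNPV}_K(x;\tau_b),$$ $$\beta_1:=\frac{\beta\lambda_0}{\tilde r-\mu},\qquad q_*:=\frac1{\sigma^2}\Bigl(-(\mu-\tfrac12\sigma^2)+\sqrt{(\mu-\tfrac12\sigma^2)^2+2\tilde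 r\sigma^2}\Bigr),\qquad b^*:=\frac{Pq_*}{\beta_1(q_*-1)} .$$ For $\kappa\ge0$ consider the utility problem over hitting times $$u^\dagger(x):=\sup_{b\ge0}J(x,b),\qquad J(x,b):=\kappa\,\mathsf P_x(\tau_b<\infty)^{q_*/(1-2\mu/\sigma^2)}+\mathrm{eNPV}_P(x;\tau_b).$$ Then $q_*>1$, $\beta_1>0$, and with $$b^\dagger:=\frac{(P-\kappa)q_*}{\beta_1(q_*-1)}$$ one has $b^\dagger=b^*-\dfrac{\kappa q_*}{\beta_1(q_*-1)}\le b^*$. Moreover, for every $x\ge0$: 1. The random variables under the expectations $\mathrm{eNPV}_K(x;\tau_b)$, $K\in\mathbb R$, $b\ge0$, are integrable. 2. The problem is the original one with $P$ replaced by $P-\kappa$: $J(x,b)=\mathrm{eNPV}_{P-\kappa}(x;\tau_b)$ for all $b\ge0$, hence $u^\dagger(x)=u_{P-\kappa}(x)$; and if $x>0$, then $u^\dagger(x)=\sup_{b\ge x}\bigl[(\beta_1b+\kappa-P)(x/b)^{q_*}\bigr]$. 3. The threshold $b^\dagger$ is optimal: $J(x,b)\le J(x,b^\dagger)=u^\dagger(x)$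 for all $b\ge0$ (if $\kappa>P$, then $b^\dagger<0$ and $\tau_{b^\dagger}=0$). If $x\ge b^\dagger$, then $b=x$ is optimal too. If $0<x<b^\dagger$, then $b^\dagger$ is the only maximizer of $J(x,\cdot)$ over $[0,\infty)$. 4. The value function is $$u^\dagger(x)=\begin{cases}(\beta_1b^\dagger+\kappa-P)\Bigl(\dfrac{x}{b^\dagger}\Bigr)^{q_*}=\dfrac{P-\kappa}{q_*-1}\Bigl(\dfrac{\beta_1(q_*-1)x}{(P-\kappa)q_*}\Bigr)^{q_*},&\kappa<P,\ 0\le x\le b^\dagger,\\[1ex]\beta_1x+\kappa-P,&x\ge b^\dagger.\end{cases}$$ -/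

import Mathlib

open MeasureTheory ProbabilityTheory
open scoped NNReal

namespace UnemploymentInsurance

noncomputable section

/-- Numerical parameters of the model: inflation rate `r`, rate `lam` of the exponential time of
losing the job, drift `μ` and volatility `σ` of the wage, and the expected discounted benefit `β`
per unit of final wage. -/
structure Params where
  r : ℝ
  lam : ℝ
  μ : ℝ
  σ : ℝ
  β : ℝ

/-- Total discount rate `r + λ₀`. -/
def Params.rTilde (m : Params) : ℝ := m.r + m.lam

/-- `β₁ = β λ₀ / (r + λ₀ - μ)`. -/
def Params.beta1 (m : Params) : ℝ := m.β * m.lam / (m.rTilde - m.μ)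

/-- The exponent `q_*`. -/
def Params.qStar (m : Params) : ℝ :=
  1 / m.σ ^ 2 * (-(m.μ - m.σ ^ 2 / 2)
    + Real.sqrt ((m.μ - m.σ ^ 2 / 2) ^ 2 + 2 * m.rTilde * m.σ ^ 2))

/-- Optimal threshold `b^*` of the problem without utility, for the premium `P`. -/
def Params.bStar (m : Params) (P : ℝ) : ℝ :=
  P * m.qStar / (m.beta1 * (m.qStar - 1))

/-- The threshold `b†` of the problem with utility weight `κ`, for the premium `P`. -/
def Params.bDag (m : Params) (P κ : ℝ) : ℝ :=
  (P - κ) * m.qStar / (m.beta1 * (m.qStar - 1))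

variable {Ω : Type*}

/-- The wage: geometric Brownian motion driven by `B`, started at `x`. -/
def wage (m : Params) (B : ℝ≥0 → Ω → ℝ) (x : ℝ) (t : ℝ≥0) (ω : Ω) : ℝ :=
  x * Real.exp ((m.μ - m.σ ^ 2 / 2) * (t : ℝ) + m.σ * B t ω)

/-- `τ_b = inf {t ≥ 0 : X_t ≥ b}`, equal to `⊤` if the set is empty. -/
def hitTime (m : Params) (B : ℝ≥0 → Ω → ℝ) (x b : ℝ) : Ω → WithTop ℝ≥0 :=
  hittingAfter (wage m B x) (Set.Ici b) 0

open Classical in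
/-- Discounted gain when the policy with premium `P` is bought at the time `τ` and the job is lost
at `τ₀`: `e^{-rτ} (e^{-r(τ₀-τ)} β X_{τ₀} - P)` on `{τ < τ₀}`, and `0` elsewhere. -/
def discountedGain (m : Params) (B : ℝ≥0 → Ω → ℝ) (τ₀ : Ω → ℝ≥0) (P x : ℝ)
    (τ : Ω → WithTop ℝ≥0) (ω : Ω) : ℝ :=
  if τ ω < (τ₀ ω : WithTop ℝ≥0) then
    Real.exp (-m.r * (((τ ω).untopD 0 : ℝ≥0) : ℝ)) *
      (Real.exp (-m.r * ((τ₀ ω : ℝ) - (((τ ω).untopD 0 : ℝ≥0) : ℝ))) * m.β * wage m B x (τ₀ ω) ω - P)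
  else 0

variable [MeasurableSpace Ω]

/-- Expected net present value of entering the scheme at the time `τ`. -/
def eNPV (Pr : Measure Ω) (m : Params) (B : ℝ≥0 → Ω → ℝ) (τ₀ : Ω → ℝ≥0) (P x : ℝ)
    (τ : Ω → WithTop ℝ≥0) : ℝ :=
  ∫ ω, discountedGain m B τ₀ P x τ ω ∂Pr

/-- The probability that the wage started at `x` ever reaches `b`. -/
def hitProb (Pr : Measure Ω) (m : Params) (B : ℝ≥0 → Ω → ℝ) (x b : ℝ) : ℝ :=
  Pr.real {ω | hitTime m B x b ω < ⊤}

/-- `κ · P_x(τ_b < ∞)^{q_* / (1 - 2μ/σ²)} + eNPV(x; τ_b)`. -/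
def utilityObjective (Pr : Measure Ω) (m : Params) (B : ℝ≥0 → Ω → ℝ) (τ₀ : Ω → ℝ≥0)
    (P κ x b : ℝ) : ℝ :=
  κ * hitProb Pr m B x b ^ (m.qStar / (1 - 2 * m.μ / m.σ ^ 2))
    + eNPV Pr m B τ₀ P x (hitTime m B x b)

/-- Value of the original problem over hitting times, `u(x) = sup_{b ≥ 0} eNPV(x; τ_b)`
(the supremum is taken in the extended reals). -/
def hitValue (Pr : Measure Ω) (m : Params) (B : ℝ≥0 → Ω → ℝ) (τ₀ : Ω → ℝ≥0) (P x : ℝ) : EReal :=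
  ⨆ b : Set.Ici (0 : ℝ), ((eNPV Pr m B τ₀ P x (hitTime m B x b) : ℝ) : EReal)

/-- Value `u†(x)` of the problem with utility over hitting times. -/
def utilityValue (Pr : Measure Ω) (m : Params) (B : ℝ≥0 → Ω → ℝ) (τ₀ : Ω → ℝ≥0)
    (P κ x : ℝ) : EReal :=
  ⨆ b : Set.Ici (0 : ℝ), ((utilityObjective Pr m B τ₀ P κ x b : ℝ) : EReal)

end

end UnemploymentInsurance

namespace UnemploymentInsurance

open Filter Set
open scoped ENNReal Topology

/-! For `x < b` the discount factor `E e^{-r̃ τ_b}` and the given power of the hitting probability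
are the same number, `(x/b)^{q_*}`. Hence the utility term equals `κ (x/b)^{q_*}`, as if `κ` were
paid back at entry, and the premium `P` becomes `P - κ`.

Both formulas come from one Laplace transform. After taking logarithms, the wage reaches `b` when
`B` reaches the line `α + γ t`, with `α = log(b/x)/σ` and `γ = (σ²/2 - μ)/σ`. Stopping the
martingale `exp(c B_s - c² s/2)` there gives `E e^{-(c²/2 - cγ)τ} = e^{-cα}` for `c > 0`, `c ≥ 2γ`
(`lintegral_exp_lineHit`). With `c = 2γ` the rate vanishes and the hitting probability appears. With
`c = σ q_*` the rate is `r̃`, because `q_*` solves `σ²q²/2 + (μ - σ²/2)q = r̃`.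

In the expected gain (`integrable_discountedGain_and_eNPV_eq`) the independent exponential time adds
`λ₀` to the discount rate. Optional stopping with `c = σ` replaces the wage at `τ₀` by `b e^{μ(τ₀ -
τ)}`. The result is `(β₁ b - K) E e^{-r̃ τ}`.

What remains is to maximise `(β₁ b - K)(x/b)^q` over `b ≥ x`. Bernoulli's inequality `1 + q(z - 1) ≤
z^q`, strict for `z ≠ 1`, does this without calculus: `z = b/b†` below the threshold, `z = b/x`
above it. -/

/-! ### Hitting a line by a continuous path -/

/-- First time a path reaches the line `α + γ t`, as a measurable functional of the path: only the
values at rational times are used. -/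
noncomputable def lineHit (α γ : ℝ) (w : ℝ≥0 → ℝ) : ℝ≥0∞ :=
  ⨅ (q : ℚ≥0) (_ : ∀ n : ℕ, ∃ p : ℚ≥0, p ≤ q ∧ α + γ * (p : ℝ≥0) - 1 / ((n : ℝ) + 1) < w p),
    ((q : ℝ≥0) : ℝ≥0∞)

lemma lineHit_lt_iff_rat (α γ : ℝ) (w : ℝ≥0 → ℝ) (s : ℝ≥0∞) :
    lineHit α γ w < s ↔ ∃ q : ℚ≥0, ((q : ℝ≥0) : ℝ≥0∞) < s ∧
      ∀ n : ℕ, ∃ p : ℚ≥0, p ≤ q ∧ α + γ * (p : ℝ≥0) - 1 / ((n : ℝ) + 1) < w p := by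
  simp only [lineHit, iInf_lt_iff]
  exact exists_congr fun q ↦ ⟨fun ⟨h, h'⟩ ↦ ⟨h', h⟩, fun ⟨h, h'⟩ ↦ ⟨h', h⟩⟩

lemma exists_nnrat_btwn_nnreal {a b : ℝ≥0} (h : a < b) : ∃ q : ℚ≥0, a < (q : ℝ≥0) ∧ (q : ℝ≥0) < b := by
  obtain ⟨q, h1, h2⟩ := exists_rat_btwn (NNReal.coe_lt_coe.2 h)
  have hq : 0 ≤ q := by
    have : (0 : ℝ) < q := lt_of_le_of_lt a.2 h1
    exact_mod_cast this.le
  lift q to ℚ≥0 using hq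
  have e : ((q : ℝ≥0) : ℝ) = ((q : ℚ) : ℝ) := by
    rw [NNRat.cast_def, NNReal.coe_div]
    simp [← NNRat.cast_def]
  exact ⟨q, NNReal.coe_lt_coe.1 (h1.trans_eq e.symm), NNReal.coe_lt_coe.1 (e.trans_lt h2)⟩

/-- The slack `1/(n+1)` lets rational times detect a path that only touches the line at an
irrational time. Conversely, compactness of `[0, q]` turns approximate contacts into an exact one.
-/
lemma lineHit_lt_iff {α γ : ℝ} {w : ℝ≥0 → ℝ} (hw : Continuous w) (s : ℝ≥0) :
    lineHit α γ w < s ↔ ∃ u < s, α + γ * u ≤ w u := by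
  rw [lineHit_lt_iff_rat]
  constructor
  · rintro ⟨q, hq, h⟩
    have hcont : Continuous fun u : ℝ≥0 ↦ w u - (α + γ * u) := by fun_prop
    obtain ⟨u, hu, hmax⟩ := (isCompact_Icc (a := (0 : ℝ≥0)) (b := (q : ℝ≥0))).exists_isMaxOn
      ⟨0, by simp⟩ hcont.continuousOn
    refine ⟨u, lt_of_le_of_lt hu.2 (by exact_mod_cast hq), ?_⟩
    by_contra! hlt
    obtain ⟨n, hn⟩ := exists_nat_one_div_lt (sub_pos.2 hlt)
    obtain ⟨p, hp, hpw⟩ := h n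
    have := hmax (⟨zero_le, by exact_mod_cast hp⟩ : (p : ℝ≥0) ∈ Icc 0 (q : ℝ≥0))
    simp only [mem_ofPred_eq] at this
    linarith
  · rintro ⟨u, hus, hu⟩
    obtain ⟨q, huq, hqs⟩ := exists_nnrat_btwn_nnreal hus
    refine ⟨q, by exact_mod_cast hqs, fun n ↦ ?_⟩
    have hcont : Continuous fun u : ℝ≥0 ↦ w u - (α + γ * u) := by fun_prop
    have hev : ∀ᶠ v in 𝓝 u, -(1 / ((n : ℝ) + 1)) < w v - (α + γ * v) :=
      hcont.continuousAt.eventually_const_lt (by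
        have : (0 : ℝ) < 1 / ((n : ℝ) + 1) := by positivity
        linarith)
    obtain ⟨l, hl, hsub⟩ := exists_Ico_subset_of_mem_nhds hev ⟨q, huq⟩
    obtain ⟨p, hp1, hp2⟩ := exists_nnrat_btwn_nnreal (lt_min hl huq)
    refine ⟨p, by exact_mod_cast (hp2.trans_le (min_le_right _ _)).le, ?_⟩
    have := hsub ⟨hp1.le, hp2.trans_le (min_le_left _ _)⟩
    simp only [mem_ofPred_eq] at this
    linarith

/-- If the path were below the line at this time, continuity would delay the first contact; if
above, contact would have come earlier. `w 0 < α` excludes a start above the line. -/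
lemma apply_lineHit {α γ : ℝ} {w : ℝ≥0 → ℝ} (hw : Continuous w) (h0 : w 0 < α)
    (hT : lineHit α γ w ≠ ∞) :
    w (lineHit α γ w).toNNReal = α + γ * (lineHit α γ w).toReal := by
  have hcont : Continuous fun u : ℝ≥0 ↦ w u - (α + γ * u) := by fun_prop
  obtain ⟨t, ht⟩ : ∃ t : ℝ≥0, lineHit α γ w = t := ⟨_, (ENNReal.coe_toNNReal hT).symm⟩
  rw [ht]
  simp only [ENNReal.toNNReal_coe, ENNReal.coe_toReal]
  have hbefore : ∀ u < t, w u < α + γ * u := by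
    intro u hu
    by_contra! hle
    exact ((lineHit_lt_iff hw t).2 ⟨u, hu, hle⟩).ne ht
  rcases lt_trichotomy (w t) (α + γ * t) with h | h | h
  · exfalso
    have hev : ∀ᶠ v in 𝓝 t, w v - (α + γ * v) < 0 :=
      hcont.continuousAt.eventually_lt_const (by linarith)
    obtain ⟨l, hl, hsub⟩ := exists_Ico_subset_of_mem_nhds hev ⟨t + 1, by simp⟩
    obtain ⟨u, hu, hle⟩ := (lineHit_lt_iff (α := α) (γ := γ) hw l).1 (by rw [ht]; exact_mod_cast hl)
    rcases lt_or_ge u t with hut | hut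
    · exact (hbefore u hut).not_ge hle
    · have := hsub ⟨hut, hu⟩
      simp only [mem_ofPred_eq] at this
      linarith
  · exact h
  · exfalso
    have ht0 : 0 < t := by
      rcases eq_or_ne t 0 with rfl | h'
      · simp at h; linarith
      · exact pos_iff_ne_zero.2 h'
    have hev : ∀ᶠ v in 𝓝 t, 0 < w v - (α + γ * v) :=
      hcont.continuousAt.eventually_const_lt (by linarith)
    obtain ⟨l, hl, hsub⟩ := exists_Ioc_subset_of_mem_nhds hev ⟨0, ht0⟩
    obtain ⟨v, hv1, hv2⟩ := exists_between hl
    have h1 := hsub ⟨hv1, hv2.le⟩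
    simp only [mem_ofPred_eq] at h1
    linarith [hbefore v hv2]

lemma le_of_le_lineHit {α γ : ℝ} {w : ℝ≥0 → ℝ} (hw : Continuous w) (h0 : w 0 < α) {t : ℝ≥0}
    (ht : (t : ℝ≥0∞) ≤ lineHit α γ w) : w t ≤ α + γ * t := by
  by_contra! h
  have hne : (t : ℝ≥0∞) ≠ lineHit α γ w := by
    intro he
    have := apply_lineHit (γ := γ) hw h0 (by rw [← he]; simp)
    rw [← he] at this
    simp at this
    linarith
  obtain ⟨s, hs1, hs2⟩ := ENNReal.lt_iff_exists_nnreal_btwn.1 (lt_of_le_of_ne ht hne)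
  exact hs2.not_ge ((lineHit_lt_iff hw s).2 ⟨t, by exact_mod_cast hs1, h.le⟩).le

lemma measurable_lineHit (α γ : ℝ) : Measurable (lineHit α γ) := by
  refine measurable_of_Iio fun s ↦ ?_
  have : lineHit α γ ⁻¹' Iio s = ⋃ (q : ℚ≥0) (_ : ((q : ℝ≥0) : ℝ≥0∞) < s), ⋂ n : ℕ,
      ⋃ (p : ℚ≥0) (_ : p ≤ q), {w | α + γ * (p : ℝ≥0) - 1 / ((n : ℝ) + 1) < w p} := by
    ext w
    simp [lineHit_lt_iff_rat]
  rw [this]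
  refine .iUnion fun q ↦ .iUnion fun _ ↦ .iInter fun n ↦ .iUnion fun p ↦ .iUnion fun _ ↦ ?_
  exact measurableSet_lt measurable_const (measurable_pi_apply _)

/-- The information up to time `s`. -/
abbrev pastAlgebra {Ω : Type*} (B : ℝ≥0 → Ω → ℝ) (s : ℝ≥0) : MeasurableSpace Ω :=
  MeasurableSpace.comap (fun ω (u : Iic s) ↦ B u ω) inferInstance

lemma measurableSet_past_lineHit_lt {Ω : Type*} (B : ℝ≥0 → Ω → ℝ) (α γ : ℝ) (s : ℝ≥0) :
    MeasurableSet[pastAlgebra B s] {ω | lineHit α γ (fun t ↦ B t ω) < s} := by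
  have : {ω | lineHit α γ (fun t ↦ B t ω) < s}
      = ⋃ (q : ℚ≥0) (_ : ((q : ℝ≥0) : ℝ≥0∞) < s), ⋂ n : ℕ,
        ⋃ (p : ℚ≥0) (_ : p ≤ q), {ω | α + γ * (p : ℝ≥0) - 1 / ((n : ℝ) + 1) < B p ω} := by
    ext w
    simp [lineHit_lt_iff_rat]
  rw [this]
  refine .iUnion fun q ↦ .iUnion fun hq ↦ .iInter fun n ↦ .iUnion fun p ↦ .iUnion fun hp ↦ ?_
  have hps : (p : ℝ≥0) ≤ s := by
    have h1 : (p : ℝ≥0) ≤ q := by exact_mod_cast hp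
    exact h1.trans (by exact_mod_cast hq.le)
  exact ⟨{v | α + γ * (p : ℝ≥0) - 1 / ((n : ℝ) + 1) < v ⟨p, hps⟩},
    measurableSet_lt measurable_const (measurable_pi_apply _), rfl⟩

/-- A sequence bounded in `L²` with constant expectation keeps it in the limit. -/
lemma lintegral_eq_of_tendsto_of_sq_bounded {Ω : Type*} [MeasurableSpace Ω] {Pr : Measure Ω}
    [IsProbabilityMeasure Pr] {f : ℕ → Ω → ℝ≥0∞} {g : Ω → ℝ≥0∞} (hf : ∀ n, Measurable (f n))
    (hlim : ∀ᵐ ω ∂Pr, Tendsto (fun n ↦ f n ω) atTop (𝓝 (g ω))) {A C : ℝ≥0∞} (hC : C ≠ ∞)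
    (hA : ∀ n, ∫⁻ ω, f n ω ∂Pr = A) (hsq : ∀ n, ∫⁻ ω, f n ω ^ 2 ∂Pr ≤ C) :
    ∫⁻ ω, g ω ∂Pr = A := by
  apply le_antisymm
  · calc ∫⁻ ω, g ω ∂Pr = ∫⁻ ω, liminf (fun n ↦ f n ω) atTop ∂Pr :=
          lintegral_congr_ae (by filter_upwards [hlim] with ω h using h.liminf_eq.symm)
      _ ≤ liminf (fun n ↦ ∫⁻ ω, f n ω ∂Pr) atTop := lintegral_liminf_le hf
      _ = A := by simp [hA]
  -- Truncating at `M` costs at most `C / M`, uniformly in `n`; the truncated functions converge by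
  -- domination, and then `M → ∞`.
  · have key : ∀ N : ℕ, A ≤ ∫⁻ ω, g ω ∂Pr + C / ((N + 1 : ℕ) : ℝ≥0∞) := by
      intro N
      set M : ℝ≥0∞ := ((N + 1 : ℕ) : ℝ≥0∞)
      have hM0 : M ≠ 0 := by simp [M]
      have hMt : M ≠ ∞ := ENNReal.natCast_ne_top _
      have hpt : ∀ x : ℝ≥0∞, x ≤ min x M + x ^ 2 / M := by
        intro x
        rcases le_total x M with h | h
        · simp [h]
        · refine le_trans ?_ le_add_self
          rw [ENNReal.le_div_iff_mul_le (Or.inl hM0) (Or.inl hMt), sq]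
          gcongr
      have h1 : ∀ n, A ≤ ∫⁻ ω, min (f n ω) M ∂Pr + C / M := by
        intro n
        calc A = ∫⁻ ω, f n ω ∂Pr := (hA n).symm
          _ ≤ ∫⁻ ω, (min (f n ω) M + f n ω ^ 2 / M) ∂Pr := lintegral_mono fun ω ↦ hpt _
          _ = ∫⁻ ω, min (f n ω) M ∂Pr + ∫⁻ ω, f n ω ^ 2 / M ∂Pr :=
            lintegral_add_left ((hf n).min measurable_const) _
          _ = ∫⁻ ω, min (f n ω) M ∂Pr + (∫⁻ ω, f n ω ^ 2 ∂Pr) / M := by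
            simp_rw [div_eq_mul_inv]
            rw [lintegral_mul_const _ ((hf n).pow_const 2)]
          _ ≤ _ := by gcongr; exact hsq n
      have h2 : Tendsto (fun n ↦ ∫⁻ ω, min (f n ω) M ∂Pr) atTop (𝓝 (∫⁻ ω, min (g ω) M ∂Pr)) := by
        refine tendsto_lintegral_of_dominated_convergence (fun _ ↦ M)
          (fun n ↦ (hf n).min measurable_const) (fun n ↦ .of_forall fun ω ↦ min_le_right _ _)
          (by simpa using hMt) ?_
        filter_upwards [hlim] with ω h using h.min tendsto_const_nhds
      calc A ≤ ∫⁻ ω, min (g ω) M ∂Pr + C / M :=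
            ge_of_tendsto' (h2.add_const _) h1
        _ ≤ _ := by gcongr; exact min_le_left _ _
    have hlim0 : Tendsto (fun N : ℕ ↦ ∫⁻ ω, g ω ∂Pr + C / ((N + 1 : ℕ) : ℝ≥0∞)) atTop
        (𝓝 (∫⁻ ω, g ω ∂Pr + 0)) := by
      refine Tendsto.const_add _ ?_
      have := ENNReal.Tendsto.const_div (a := C) (ENNReal.tendsto_nat_nhds_top.comp
        (tendsto_add_atTop_nat 1)) (Or.inr hC)
      simpa using this
    simpa using ge_of_tendsto' hlim0 key

/-! ### The exponential martingale -/

section Brownian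

variable {Ω : Type*} [MeasurableSpace Ω] {Pr : Measure Ω} {B : ℝ≥0 → Ω → ℝ}

/-- The exponential martingale `exp (c B_s - c² s / 2)`. -/
noncomputable def expMart (B : ℝ≥0 → Ω → ℝ) (c : ℝ) (s : ℝ≥0) (ω : Ω) : ℝ≥0∞ :=
  ENNReal.ofReal (Real.exp (c * B s ω - c ^ 2 * s / 2))

lemma measurable_expMart (hBm : ∀ t, Measurable (B t)) (c : ℝ) (s : ℝ≥0) :
    Measurable (expMart B c s) := by
  have := hBm s
  unfold expMart
  fun_prop

lemma lintegral_expMart (hB : IsPreBrownianReal B Pr) (c : ℝ) (t : ℝ≥0) :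
    ∫⁻ ω, expMart B c t ω ∂Pr = 1 := by
  have hl := hB.hasLaw_eval t
  have hint : Integrable (fun ω ↦ Real.exp (c * B t ω)) Pr := by
    have := integrable_exp_mul_gaussianReal (μ := 0) (v := t) c
    rw [← hl.map_eq] at this
    exact this.comp_aemeasurable hl.aemeasurable
  have hmgf := mgf_gaussianReal hl.map_eq c
  have : ∀ ω, expMart B c t ω
      = ENNReal.ofReal (Real.exp (c * B t ω) * Real.exp (-(c ^ 2 * t / 2))) := by
    intro ω
    rw [expMart, ← Real.exp_add, sub_eq_add_neg]
  simp_rw [this]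
  rw [← ofReal_integral_eq_lintegral_ofReal (hint.mul_const _) (.of_forall fun ω ↦ by positivity),
    integral_mul_const]
  rw [mgf] at hmgf
  rw [hmgf, ← Real.exp_add]
  rw [show (0 * c + (t : ℝ) * c ^ 2 / 2 + -(c ^ 2 * t / 2)) = 0 by ring]
  simp

/-- The martingale at `t` is its value at `s` times a factor built from the increments after `s`,
which is independent of the past and has mean one. -/
lemma setLIntegral_expMart (hBm : ∀ t, Measurable (B t)) (hB : IsPreBrownianReal B Pr) (c : ℝ)
    {s t : ℝ≥0} (hst : s ≤ t) {E : Set Ω} (hE : MeasurableSet[pastAlgebra B s] E) :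
    ∫⁻ ω in E, expMart B c t ω ∂Pr = ∫⁻ ω in E, expMart B c s ω ∂Pr := by
  obtain ⟨S, hS, rfl⟩ := hE
  have hmeasE : MeasurableSet ((fun ω (u : Iic s) ↦ B u ω) ⁻¹' S) :=
    have hm : Measurable (fun ω (u : Iic s) ↦ B u ω) := measurable_pi_lambda _ fun u ↦ hBm u
    hm hS
  set φ : (Iic s → ℝ) → ℝ≥0∞ := fun v ↦
    S.indicator (fun v ↦ ENNReal.ofReal (Real.exp (c * v ⟨s, mem_Iic.2 le_rfl⟩ - c ^ 2 * s / 2))) v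
  have hφ : Measurable φ := Measurable.indicator (by fun_prop) hS
  set ψ : (ℝ≥0 → ℝ) → ℝ≥0∞ := fun v ↦
    ENNReal.ofReal (Real.exp (c * v (t - s) - c ^ 2 * (t - s : ℝ≥0) / 2))
  have hψ : Measurable ψ := by fun_prop
  have hind := (hB.indepFun_shift s).comp hψ hφ
  have hprod := lintegral_mul_eq_lintegral_mul_lintegral_of_indepFun
    (hψ.comp (measurable_pi_lambda (fun ω u ↦ B (s + u) ω - B s ω) fun u ↦ (hBm _).sub (hBm _)))
    (hφ.comp (measurable_pi_lambda (fun ω (u : Iic s) ↦ B u ω) fun u ↦ hBm u)) hind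
  have h1 : ∫⁻ ω, (ψ ∘ fun ω u ↦ B (s + u) ω - B s ω) ω ∂Pr = 1 :=
    lintegral_expMart (hB.shift s) c (t - s)
  rw [h1, one_mul] at hprod
  rw [← lintegral_indicator hmeasE, ← lintegral_indicator hmeasE]
  refine Eq.trans (lintegral_congr fun ω ↦ ?_) (hprod.trans (lintegral_congr fun ω ↦ ?_))
  · by_cases h : (fun u : Iic s ↦ B u ω) ∈ S
    · rw [indicator_of_mem (by exact h)]
      simp only [Pi.mul_apply, Function.comp, φ, ψ, indicator_of_mem h, expMart]
      rw [← ENNReal.ofReal_mul (by positivity), ← Real.exp_add, add_tsub_cancel_of_le hst,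
        NNReal.coe_sub hst]
      congr 2
      ring
    · rw [indicator_of_notMem (by exact h)]
      simp [φ, indicator_of_notMem h]
  · by_cases h : (fun u : Iic s ↦ B u ω) ∈ S
    · rw [indicator_of_mem (by exact h)]
      simp [φ, indicator_of_mem h, expMart]
    · rw [indicator_of_notMem (by exact h)]
      simp [φ, indicator_of_notMem h]

end Brownian

/-! ### Discretising a random time -/

/-- The index `k` of the grid cell `[t k / (n + 1), t (k + 1) / (n + 1))` containing `T`. -/
noncomputable def gridIndex (t : ℝ≥0) (n : ℕ) (T : ℝ≥0∞) : ℕ :=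
  ⌊((n : ℝ≥0) + 1) * T.toNNReal / t⌋₊

/-- The right end of the `k`-th grid cell. -/
noncomputable def gridPoint (t : ℝ≥0) (n k : ℕ) : ℝ≥0 := t * (k + 1) / (n + 1)

lemma measurable_gridIndex (t : ℝ≥0) (n : ℕ) : Measurable (gridIndex t n) := by
  unfold gridIndex
  fun_prop

lemma gridIndex_eq_iff {t : ℝ≥0} (ht : 0 < t) (n k : ℕ) {T : ℝ≥0∞} (hT : T ≠ ∞) :
    gridIndex t n T = k ↔ T < gridPoint t n k ∧ ¬ T < (t * k / (n + 1) : ℝ≥0) := by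
  lift T to ℝ≥0 using hT
  have hn : (0 : ℝ≥0) < n + 1 := by positivity
  rw [gridIndex, Nat.floor_eq_iff zero_le, ENNReal.toNNReal_coe, gridPoint, not_lt]
  norm_cast
  rw [le_div_iff₀ ht, div_lt_iff₀ ht, lt_div_iff₀ (by exact_mod_cast hn),
    div_le_iff₀ (by exact_mod_cast hn), and_comm]
  push_cast
  rw [mul_comm T, mul_comm t, mul_comm t]

lemma gridIndex_lt_iff {t : ℝ≥0} (ht : 0 < t) (n : ℕ) {T : ℝ≥0∞} (hT : T ≠ ∞) :
    gridIndex t n T < n + 1 ↔ T < t := by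
  lift T to ℝ≥0 using hT
  have hn : (0 : ℝ≥0) < n + 1 := by positivity
  rw [gridIndex, Nat.floor_lt zero_le, ENNReal.toNNReal_coe, div_lt_iff₀ ht]
  push_cast
  rw [mul_lt_mul_iff_right₀ hn, ENNReal.coe_lt_coe]

lemma gridPoint_le {t : ℝ≥0} {n k : ℕ} (h : k < n + 1) : gridPoint t n k ≤ t := by
  have hn : (0 : ℝ≥0) < n + 1 := by positivity
  rw [gridPoint, div_le_iff₀ hn]
  gcongr
  exact_mod_cast Nat.lt_succ_iff.1 h

lemma tendsto_gridPoint {t : ℝ≥0} (ht : 0 < t) {T : ℝ≥0∞} (hT : T ≠ ∞) :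
    Tendsto (fun n ↦ gridPoint t n (gridIndex t n T)) atTop (𝓝 T.toNNReal) := by
  have hbd : ∀ n : ℕ, T.toNNReal ≤ gridPoint t n (gridIndex t n T) ∧
      gridPoint t n (gridIndex t n T) ≤ T.toNNReal + t / (n + 1) := by
    intro n
    obtain ⟨h1, h2⟩ := (gridIndex_eq_iff ht n _ hT).1 rfl
    lift T to ℝ≥0 using hT
    rw [not_lt, ENNReal.coe_le_coe] at h2
    rw [ENNReal.coe_lt_coe] at h1
    refine ⟨h1.le, ?_⟩
    rw [gridPoint, mul_add, add_div, mul_one, ENNReal.toNNReal_coe]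
    gcongr
  refine tendsto_of_tendsto_of_tendsto_of_le_of_le tendsto_const_nhds ?_ (fun n ↦ (hbd n).1)
    (fun n ↦ (hbd n).2)
  have : Tendsto (fun n : ℕ ↦ t / ((n : ℝ≥0) + 1)) atTop (𝓝 0) := by
    rw [← NNReal.tendsto_coe]
    push_cast
    simpa [div_eq_mul_inv] using (tendsto_one_div_add_atTop_nhds_zero_nat (𝕜 := ℝ)).const_mul (t : ℝ)
  simpa using this.const_add T.toNNReal

/-! ### Optional stopping and the Laplace transform -/

section Brownian

variable {Ω : Type*} [MeasurableSpace Ω] {Pr : Measure Ω} {B : ℝ≥0 → Ω → ℝ}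

lemma pastAlgebra_le (hBm : ∀ t, Measurable (B t)) (s : ℝ≥0) :
    pastAlgebra B s ≤ ‹MeasurableSpace Ω› :=
  Measurable.comap_le (measurable_pi_lambda _ fun u ↦ hBm u)

lemma measurable_apply_nat_index {f : ℕ → Ω → ℝ≥0∞} (hf : ∀ k, Measurable (f k)) {N : Ω → ℕ}
    (hN : Measurable N) : Measurable fun ω ↦ f (N ω) ω := by
  have h : Measurable fun p : ℕ × Ω ↦ f p.1 p.2 := measurable_from_prod_countable_right hf
  exact h.comp (hN.prodMk measurable_id)

lemma measurable_expMart_gridPoint (hBm : ∀ t, Measurable (B t)) {T : Ω → ℝ≥0∞}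
    (hT : Measurable T) (c : ℝ) (t : ℝ≥0) (n : ℕ) :
    Measurable fun ω ↦ expMart B c (gridPoint t n (gridIndex t n (T ω))) ω :=
  measurable_apply_nat_index (f := fun k ↦ expMart B c (gridPoint t n k))
    (fun _ ↦ measurable_expMart hBm c _) (N := fun ω ↦ gridIndex t n (T ω))
    ((measurable_gridIndex t n).comp hT)

/-- Optional stopping at the discretised time. -/
lemma setLIntegral_expMart_gridPoint (hBm : ∀ t, Measurable (B t)) (hB : IsPreBrownianReal B Pr)
    {T : Ω → ℝ≥0∞} (hT : ∀ s : ℝ≥0, MeasurableSet[pastAlgebra B s] {ω | T ω < s})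
    (c : ℝ) {t : ℝ≥0} (ht : 0 < t) (n : ℕ) :
    ∫⁻ ω in {ω | T ω < t}, expMart B c (gridPoint t n (gridIndex t n (T ω))) ω ∂Pr
      = ∫⁻ ω in {ω | T ω < t}, expMart B c t ω ∂Pr := by
  -- Rounding up matters: `E k` is known by the right end of its cell, so the martingale property
  -- applies cell by cell between that point and `t`.
  set E : ℕ → Set Ω := fun k ↦ {ω | T ω < gridPoint t n k} \ {ω | T ω < (t * k / (n + 1) : ℝ≥0)}
    with hE
  have hmemE : ∀ k ω, ω ∈ E k → T ω ≠ ∞ ∧ gridIndex t n (T ω) = k := fun k ω h ↦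
    ⟨h.1.ne_top, (gridIndex_eq_iff ht n k h.1.ne_top).2 h⟩
  have hpast : ∀ k, MeasurableSet[pastAlgebra B (gridPoint t n k)] (E k) := by
    intro k
    refine (hT _).diff ?_
    have hle : (t * k / (n + 1) : ℝ≥0) ≤ gridPoint t n k := by
      rw [gridPoint]; gcongr; simp
    obtain ⟨S, hS, hSe⟩ := hT (t * k / (n + 1))
    rw [← hSe]
    refine ⟨(fun v (u : Iic (t * k / (n + 1) : ℝ≥0)) ↦ v ⟨u, u.2.trans hle⟩) ⁻¹' S, ?_, rfl⟩
    have hm : Measurable fun (v : Iic (gridPoint t n k) → ℝ) (u : Iic (t * k / (n + 1) : ℝ≥0)) ↦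
      v ⟨u, u.2.trans hle⟩ := by fun_prop
    exact hm hS
  have hmeas : ∀ k, MeasurableSet (E k) := fun k ↦ pastAlgebra_le hBm _ _ (hpast k)
  have hunion : {ω | T ω < t} = ⋃ k ∈ Finset.range (n + 1), E k := by
    ext ω
    simp only [mem_ofPred_eq, mem_iUnion, Finset.mem_range, exists_prop]
    constructor
    · intro h
      exact ⟨gridIndex t n (T ω), (gridIndex_lt_iff ht n h.ne_top).2 h,
        (gridIndex_eq_iff ht n _ h.ne_top).1 rfl⟩
    · rintro ⟨k, hk, hω⟩
      obtain ⟨h1, h2⟩ := hmemE k ω hω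
      exact (gridIndex_lt_iff ht n h1).1 (h2 ▸ hk)
  have hdisj : ((Finset.range (n + 1) : Finset ℕ) : Set ℕ).PairwiseDisjoint E := by
    intro i _ j _ hij
    refine Set.disjoint_left.2 fun ω hi hj ↦ hij ?_
    rw [← (hmemE i ω hi).2, (hmemE j ω hj).2]
  rw [hunion, lintegral_biUnion_finset hdisj fun k _ ↦ hmeas k,
    lintegral_biUnion_finset hdisj fun k _ ↦ hmeas k]
  refine Finset.sum_congr rfl fun k hk ↦ ?_
  rw [setLIntegral_expMart hBm hB c (gridPoint_le (Finset.mem_range.1 hk)) (hpast k)]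
  refine setLIntegral_congr_fun (hmeas k) fun ω hω ↦ ?_
  simp only [(hmemE k ω hω).2]

/-- Optional stopping for the exponential martingale at a time `T` with `{T < s}` in the past of
`s`. -/
lemma setLIntegral_expMart_stopped [IsProbabilityMeasure Pr] (hBm : ∀ t, Measurable (B t))
    (hB : IsBrownianReal B Pr) {T : Ω → ℝ≥0∞} (hTm : Measurable T)
    (hT : ∀ s : ℝ≥0, MeasurableSet[pastAlgebra B s] {ω | T ω < s})
    (c : ℝ) {t : ℝ≥0} (ht : 0 < t) :
    ∫⁻ ω in {ω | T ω < t}, expMart B c (T ω).toNNReal ω ∂Pr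
      = ∫⁻ ω in {ω | T ω < t}, expMart B c t ω ∂Pr := by
  have hS : MeasurableSet {ω | T ω < t} := pastAlgebra_le hBm _ _ (hT t)
  rw [← lintegral_indicator hS]
  refine lintegral_eq_of_tendsto_of_sq_bounded (f := fun n ↦ {ω | T ω < t}.indicator
    fun ω ↦ expMart B c (gridPoint t n (gridIndex t n (T ω))) ω)
    (C := ENNReal.ofReal (Real.exp (c ^ 2 * t))) (fun n ↦
      (measurable_expMart_gridPoint hBm hTm c t n).indicator hS) ?_ (by simp) (fun n ↦ ?_)
    (fun n ↦ ?_)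
  · filter_upwards [hB.cont] with ω hω
    by_cases h : T ω < t
    · simp only [indicator_of_mem (show ω ∈ {ω | T ω < t} from h)]
      have hc : Continuous fun s ↦ expMart B c s ω := 
        ENNReal.continuous_ofReal.comp (by fun_prop)
      exact (hc.tendsto _).comp (tendsto_gridPoint ht h.ne_top)
    · simp only [indicator_of_notMem (show ω ∉ {ω | T ω < t} from h)]
      exact tendsto_const_nhds
  · rw [lintegral_indicator hS, setLIntegral_expMart_gridPoint hBm hB.toIsPreBrownianReal hT c ht n]
  -- The square of the martingale with parameter `c` at time `s` is `e^{c² s}` times the one with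
  -- parameter `2c`, whose discretised stopping is already known.
  · calc ∫⁻ ω, ({ω | T ω < t}.indicator
          (fun ω ↦ expMart B c (gridPoint t n (gridIndex t n (T ω))) ω) ω) ^ 2 ∂Pr
        ≤ ∫⁻ ω, {ω | T ω < t}.indicator (fun ω ↦ ENNReal.ofReal (Real.exp (c ^ 2 * t)) *
            expMart B (2 * c) (gridPoint t n (gridIndex t n (T ω))) ω) ω ∂Pr := by
          refine lintegral_mono fun ω ↦ ?_
          by_cases h : T ω < t
          · rw [indicator_of_mem (show ω ∈ {ω | T ω < t} from h),
              indicator_of_mem (show ω ∈ {ω | T ω < t} from h), expMart, expMart,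
              ← ENNReal.ofReal_pow (by positivity), ← ENNReal.ofReal_mul (by positivity),
              ← Real.exp_nat_mul, ← Real.exp_add]
            refine ENNReal.ofReal_le_ofReal (Real.exp_le_exp.2 ?_)
            have : ((gridPoint t n (gridIndex t n (T ω)) : ℝ≥0) : ℝ) ≤ t :=
              gridPoint_le ((gridIndex_lt_iff ht n h.ne_top).2 h)
            have := mul_le_mul_of_nonneg_left this (sq_nonneg c)
            push_cast
            nlinarith
          · simp [indicator_of_notMem (show ω ∉ {ω | T ω < t} from h)]
      _ = ENNReal.ofReal (Real.exp (c ^ 2 * t)) *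
            ∫⁻ ω in {ω | T ω < t}, expMart B (2 * c) t ω ∂Pr := by
          rw [lintegral_indicator hS, lintegral_const_mul _
            (measurable_expMart_gridPoint hBm hTm _ t n),
            setLIntegral_expMart_gridPoint hBm hB.toIsPreBrownianReal hT _ ht n]
      _ ≤ ENNReal.ofReal (Real.exp (c ^ 2 * t)) * 1 := by
          gcongr
          exact (setLIntegral_le_lintegral _ _).trans
            (lintegral_expMart hB.toIsPreBrownianReal _ _).le
      _ = _ := mul_one _

variable [IsProbabilityMeasure Pr]

lemma measurable_path (hBm : ∀ t, Measurable (B t)) : Measurable fun ω t ↦ B t ω :=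
  measurable_pi_lambda _ hBm

lemma measurable_lineHit_comp (hBm : ∀ t, Measurable (B t)) (α γ : ℝ) :
    Measurable fun ω ↦ lineHit α γ (fun t ↦ B t ω) :=
  (measurable_lineHit α γ).comp (measurable_path hBm)

/-- Optional stopping at the hitting time of a line. -/
lemma setLIntegral_expMart_lineHit (hBm : ∀ t, Measurable (B t)) (hB : IsBrownianReal B Pr)
    {α : ℝ} (hα : 0 < α) (γ c : ℝ) {t : ℝ≥0} (ht : 0 < t) :
    ∫⁻ ω in {ω | lineHit α γ (fun t ↦ B t ω) < t}, expMart B c t ω ∂Pr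
      = ∫⁻ ω in {ω | lineHit α γ (fun t ↦ B t ω) < t}, ENNReal.ofReal (Real.exp
          (c * α + (c * γ - c ^ 2 / 2) * (lineHit α γ (fun t ↦ B t ω)).toReal)) ∂Pr := by
  have hTm := measurable_lineHit_comp hBm α γ
  rw [← setLIntegral_expMart_stopped hBm hB hTm (measurableSet_past_lineHit_lt B α γ) c ht]
  refine setLIntegral_congr_fun_ae (measurableSet_lt hTm measurable_const) ?_
  filter_upwards [hB.cont, hB.eval_zero_ae_eq_zero] with ω hω h0 hT
  rw [expMart, apply_lineHit hω (by rwa [h0]) (ne_top_of_lt hT)]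
  congr 2
  rw [ENNReal.coe_toNNReal_eq_toReal]
  ring

/-- Laplace transform of the hitting time of a line by a Brownian motion. -/
lemma lintegral_exp_lineHit (hBm : ∀ t, Measurable (B t)) (hB : IsBrownianReal B Pr)
    {α γ c : ℝ} (hα : 0 < α) (hc : 0 < c) (hγ : 2 * γ ≤ c) :
    ∫⁻ ω in {ω | lineHit α γ (fun t ↦ B t ω) < ∞}, ENNReal.ofReal (Real.exp
      (-(c ^ 2 / 2 - c * γ) * (lineHit α γ (fun t ↦ B t ω)).toReal)) ∂Pr
      = ENNReal.ofReal (Real.exp (-(c * α))) := by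
  set T : Ω → ℝ≥0∞ := fun ω ↦ lineHit α γ (fun t ↦ B t ω) with hTdef
  have hTm : Measurable T := measurable_lineHit_comp hBm α γ
  have hS : ∀ n : ℕ, MeasurableSet {ω | T ω < ((n + 1 : ℕ) : ℝ≥0)} := fun n ↦
    measurableSet_lt hTm measurable_const
  set f : Ω → ℝ≥0∞ := fun ω ↦
    ENNReal.ofReal (Real.exp (c * α + (c * γ - c ^ 2 / 2) * (T ω).toReal)) with hf
  -- On `{T ≥ t}` one has `B_t ≤ α + γ t`. Bounding only half of the exponent `c B_t` this way, and
  -- keeping the martingale with parameter `c/2`, gives decay at rate `δ ≥ c²/8`. Bounding all of it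
  -- would give no decay in the case `c = 2γ`.
  set δ : ℝ := 3 * c ^ 2 / 8 - c * γ / 2 with hδ
  have hδpos : 0 < δ := by
    rw [hδ]
    nlinarith [mul_le_mul_of_nonneg_left hγ hc.le, mul_pos hc hc]
  have hsplit : ∀ n : ℕ, ∫⁻ ω in {ω | T ω < ((n + 1 : ℕ) : ℝ≥0)}, f ω ∂Pr
      + ∫⁻ ω in {ω | T ω < ((n + 1 : ℕ) : ℝ≥0)}ᶜ, expMart B c ((n + 1 : ℕ) : ℝ≥0) ω ∂Pr = 1 := by
    intro n
    rw [hf, ← setLIntegral_expMart_lineHit hBm hB hα γ c (by positivity),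
      lintegral_add_compl _ (hS n), lintegral_expMart hB.toIsPreBrownianReal]
  have hrest : ∀ n : ℕ,
      ∫⁻ ω in {ω | T ω < ((n + 1 : ℕ) : ℝ≥0)}ᶜ, expMart B c ((n + 1 : ℕ) : ℝ≥0) ω ∂Pr
        ≤ ENNReal.ofReal (Real.exp (c * α / 2) * Real.exp (-δ * ((n + 1 : ℕ) : ℝ))) := by
    intro n
    set t : ℝ≥0 := ((n + 1 : ℕ) : ℝ≥0)
    calc ∫⁻ ω in {ω | T ω < t}ᶜ, expMart B c t ω ∂Pr
        ≤ ∫⁻ ω in {ω | T ω < t}ᶜ, ENNReal.ofReal (Real.exp (c * α / 2) * Real.exp (-δ * t))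
            * expMart B (c / 2) t ω ∂Pr := by
          refine setLIntegral_mono_ae' (hS n).compl ?_
          filter_upwards [hB.cont, hB.eval_zero_ae_eq_zero] with ω hω h0 hT
          have hle : B t ω ≤ α + γ * t :=
            le_of_le_lineHit hω (by rwa [h0]) (not_lt.1 hT)
          rw [expMart, expMart, ← ENNReal.ofReal_mul (by positivity), ← Real.exp_add,
            ← Real.exp_add]
          refine ENNReal.ofReal_le_ofReal (Real.exp_le_exp.2 ?_)
          rw [hδ]
          nlinarith [mul_le_mul_of_nonneg_left hle hc.le]
      _ ≤ ∫⁻ ω, ENNReal.ofReal (Real.exp (c * α / 2) * Real.exp (-δ * t))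
            * expMart B (c / 2) t ω ∂Pr := setLIntegral_le_lintegral _ _
      _ = _ := by
          rw [lintegral_const_mul _ (measurable_expMart hBm _ _),
            lintegral_expMart hB.toIsPreBrownianReal, mul_one]
          simp [t]
  have hrest0 : Tendsto (fun n : ℕ ↦
      ∫⁻ ω in {ω | T ω < ((n + 1 : ℕ) : ℝ≥0)}ᶜ, expMart B c ((n + 1 : ℕ) : ℝ≥0) ω ∂Pr)
      atTop (𝓝 0) := by
    refine tendsto_of_tendsto_of_tendsto_of_le_of_le tendsto_const_nhds ?_ (fun _ ↦ zero_le) hrest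
    rw [← ENNReal.ofReal_zero]
    refine ENNReal.tendsto_ofReal ?_
    rw [← mul_zero (Real.exp (c * α / 2))]
    refine Tendsto.const_mul _ (Real.tendsto_exp_atBot.comp ?_)
    refine Tendsto.const_mul_atTop_of_neg (by linarith) ?_
    exact tendsto_natCast_atTop_atTop.comp (tendsto_add_atTop_nat 1)
  have hunion : {ω | T ω < ∞} = ⋃ n : ℕ, {ω | T ω < ((n + 1 : ℕ) : ℝ≥0)} := by
    ext ω
    simp only [mem_ofPred_eq, mem_iUnion]
    refine ⟨fun h ↦ ?_, fun ⟨n, hn⟩ ↦ hn.trans ENNReal.coe_lt_top⟩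
    obtain ⟨n, hn⟩ := ENNReal.exists_nat_gt h.ne
    exact ⟨n, hn.trans_le (by push_cast; exact le_self_add)⟩
  have hmono : Monotone fun n : ℕ ↦ {ω | T ω < ((n + 1 : ℕ) : ℝ≥0)} := by
    intro i j hij ω hω
    refine lt_of_lt_of_le (show T ω < ((i + 1 : ℕ) : ℝ≥0) from hω) ?_
    gcongr
  have hlim : Tendsto (fun n : ℕ ↦ ∫⁻ ω in {ω | T ω < ((n + 1 : ℕ) : ℝ≥0)}, f ω ∂Pr) atTop
      (𝓝 (∫⁻ ω in {ω | T ω < ∞}, f ω ∂Pr)) := by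
    rw [hunion, setLIntegral_iUnion_of_directed _ hmono.directed_le]
    exact tendsto_atTop_iSup fun i j hij ↦ lintegral_mono_set (hmono hij)
  have htotal : ∫⁻ ω in {ω | T ω < ∞}, f ω ∂Pr = 1 := by
    have := hlim.add hrest0
    simp_rw [hsplit, add_zero] at this
    exact (tendsto_nhds_unique this tendsto_const_nhds)
  have hfe : ∀ ω, ENNReal.ofReal (Real.exp (-(c ^ 2 / 2 - c * γ) * (T ω).toReal))
      = ENNReal.ofReal (Real.exp (-(c * α))) * f ω := by
    intro ω
    rw [hf, ← ENNReal.ofReal_mul (by positivity), ← Real.exp_add]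
    congr 2
    ring
  rw [lintegral_congr hfe, lintegral_const_mul _ (by rw [hf]; fun_prop), htotal, mul_one]

/-- Probability that a Brownian motion ever reaches an increasing line. -/
lemma measure_lineHit_lt_top (hBm : ∀ t, Measurable (B t)) (hB : IsBrownianReal B Pr)
    {α γ : ℝ} (hα : 0 < α) (hγ : 0 < γ) :
    Pr {ω | lineHit α γ (fun t ↦ B t ω) < ∞} = ENNReal.ofReal (Real.exp (-(2 * γ * α))) := by
  -- For `c = 2γ` the rate is zero and the transform is the probability itself.
  rw [← lintegral_exp_lineHit hBm hB hα (by positivity : 0 < 2 * γ) le_rfl,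
    show (2 * γ) ^ 2 / 2 - 2 * γ * γ = 0 by ring]
  simp

end Brownian

/-! ### Joint measurability and the exponential time -/

/-- Evaluation of a path, jointly measurable in the path and the time; it is the true value for
continuous paths. -/
noncomputable def pathEval (w : ℝ≥0 → ℝ) (t : ℝ≥0) : ℝ :=
  limsup (fun n : ℕ ↦ w (gridPoint 1 n (gridIndex 1 n t))) atTop

lemma pathEval_eq {w : ℝ≥0 → ℝ} (hw : Continuous w) (t : ℝ≥0) : pathEval w t = w t := by
  have := tendsto_gridPoint one_pos (ENNReal.coe_ne_top (r := t))
  rw [ENNReal.toNNReal_coe] at this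
  exact ((hw.tendsto t).comp this).limsup_eq

lemma measurable_pathEval : Measurable fun p : (ℝ≥0 → ℝ) × ℝ≥0 ↦ pathEval p.1 p.2 := by
  refine Measurable.limsup fun n ↦ ?_
  have h : Measurable fun q : ℕ × (ℝ≥0 → ℝ) ↦ q.2 (gridPoint 1 n q.1) :=
    measurable_from_prod_countable_right fun k ↦ measurable_pi_apply (gridPoint 1 n k)
  have h2 : Measurable fun p : (ℝ≥0 → ℝ) × ℝ≥0 ↦ (gridIndex 1 n (p.2 : ℝ≥0∞), p.1) :=
    ((measurable_gridIndex 1 n).comp (by fun_prop)).prodMk measurable_fst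
  exact h.comp h2

/-- Used with `δ = r - μ` for the wage term and with `δ = 0`, a survival probability, for the
premium. -/
lemma lintegral_exp_tail {E : Measure ℝ≥0} {l : ℝ} (hl : 0 < l)
    (hE : E.map (fun t : ℝ≥0 ↦ (t : ℝ)) = expMeasure l) {δ : ℝ} (hδ : 0 < l + δ) (s : ℝ≥0) :
    ∫⁻ t in Ioi s, ENNReal.ofReal (Real.exp (-δ * t)) ∂E
      = ENNReal.ofReal (l / (l + δ) * Real.exp (-(l + δ) * s)) := by
  have h1 : ∫⁻ t in Ioi s, ENNReal.ofReal (Real.exp (-δ * t)) ∂E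
      = ∫⁻ y in Ioi (s : ℝ), ENNReal.ofReal (Real.exp (-δ * y)) ∂(expMeasure l) := by
    rw [← hE, setLIntegral_map measurableSet_Ioi (by fun_prop) (by fun_prop)]
    congr 2
  have h2 : ∫⁻ y in Ioi (s : ℝ), ENNReal.ofReal (Real.exp (-δ * y)) ∂(expMeasure l)
      = ∫⁻ y in Ioi (s : ℝ), ENNReal.ofReal (l * Real.exp (-(l + δ) * y)) := by
    have hpdf : Measurable (gammaPDF 1 l) := (measurable_gammaPDFReal 1 l).ennreal_ofReal
    rw [expMeasure, gammaMeasure, setLIntegral_withDensity_eq_setLIntegral_mul _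
      hpdf (by fun_prop) measurableSet_Ioi]
    refine setLIntegral_congr_fun measurableSet_Ioi fun y hy ↦ ?_
    have hy0 : 0 ≤ y := s.2.trans (le_of_lt hy)
    have := exponentialPDF_of_nonneg (r := l) hy0
    rw [exponentialPDF, exponentialPDFReal] at this
    simp only [Pi.mul_apply, gammaPDF]
    rw [this, ← ENNReal.ofReal_mul (by positivity), mul_assoc, ← Real.exp_add]
    congr 3
    ring
  rw [h1, h2, ← ofReal_integral_eq_lintegral_ofReal
    ((exp_neg_integrableOn_Ioi _ hδ).const_mul l) (.of_forall fun y ↦ by positivity),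
    integral_const_mul, integral_exp_mul_Ioi (by linarith)]
  congr 1
  field_simp

/-! ### The expected gain -/

section Model

variable {Ω : Type*} [MeasurableSpace Ω] {Pr : Measure Ω} [IsProbabilityMeasure Pr]
  {B : ℝ≥0 → Ω → ℝ} {τ₀ : Ω → ℝ≥0}

/-- Fixing the path first allows integration of the exponential law; the reverse order, in
`lintegral_path_time_symm`, allows optional stopping at a deterministic time. -/
lemma lintegral_path_time (hBm : ∀ t, Measurable (B t)) (hτm : Measurable τ₀)
    (hind : IndepFun (fun ω t ↦ B t ω) τ₀ Pr) {Ψ : (ℝ≥0 → ℝ) × ℝ≥0 → ℝ≥0∞} (hΨ : Measurable Ψ) :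
    ∫⁻ ω, Ψ (fun t ↦ B t ω, τ₀ ω) ∂Pr = ∫⁻ ω, ∫⁻ t, Ψ (fun t ↦ B t ω, t) ∂(Pr.map τ₀) ∂Pr := by
  have hp := measurable_path hBm
  have := Measure.isProbabilityMeasure_map (μ := Pr) hτm.aemeasurable
  have := Measure.isProbabilityMeasure_map (μ := Pr) hp.aemeasurable
  rw [← lintegral_map hΨ (hp.prodMk hτm),
    (indepFun_iff_map_prod_eq_prod_map_map hp.aemeasurable hτm.aemeasurable).1 hind,
    lintegral_prod _ hΨ.aemeasurable, lintegral_map hΨ.lintegral_prod_right' hp]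

lemma lintegral_path_time_symm (hBm : ∀ t, Measurable (B t)) (hτm : Measurable τ₀)
    (hind : IndepFun (fun ω t ↦ B t ω) τ₀ Pr) {Ψ : (ℝ≥0 → ℝ) × ℝ≥0 → ℝ≥0∞} (hΨ : Measurable Ψ) :
    ∫⁻ ω, Ψ (fun t ↦ B t ω, τ₀ ω) ∂Pr = ∫⁻ t, ∫⁻ ω, Ψ (fun t ↦ B t ω, t) ∂Pr ∂(Pr.map τ₀) := by
  have hp := measurable_path hBm
  have := Measure.isProbabilityMeasure_map (μ := Pr) hτm.aemeasurable
  have hmeas : Measurable fun q : Ω × ℝ≥0 ↦ Ψ (fun t ↦ B t q.1, q.2) :=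
    hΨ.comp ((hp.comp measurable_fst).prodMk measurable_snd)
  rw [lintegral_path_time hBm hτm hind hΨ, lintegral_lintegral_swap hmeas.aemeasurable]

variable {m : Params}

/-- Expected gain at a time `τ` determined by the path, from its Laplace transform at `r + λ₀` and
an optional stopping identity for the wage. -/
theorem integrable_discountedGain_and_eNPV_eq (hlam : 0 < m.lam)
    (hμ : m.μ < m.rTilde) (hBm : ∀ t, Measurable (B t)) (hB : IsBrownianReal B Pr)
    (hτm : Measurable τ₀) (hτlaw : HasLaw (fun ω ↦ (τ₀ ω : ℝ)) (expMeasure m.lam) Pr)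
    (hind : IndepFun (fun ω t ↦ B t ω) τ₀ Pr) {x b ρ : ℝ} (hx : 0 ≤ x) (hb : 0 ≤ b) (hρ : 0 ≤ ρ)
    {τ : Ω → WithTop ℝ≥0} {F : (ℝ≥0 → ℝ) → ℝ≥0∞} (hF : Measurable F)
    (hτF : ∀ᵐ ω ∂Pr, τ ω = F (fun t ↦ B t ω))
    (hwage : ∀ t : ℝ≥0, ∫⁻ ω in {ω | F (fun t ↦ B t ω) < t}, ENNReal.ofReal (wage m B x t ω) ∂Pr
      = ∫⁻ ω in {ω | F (fun t ↦ B t ω) < t}, ENNReal.ofReal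
          (b * Real.exp (m.μ * (t - (F (fun t ↦ B t ω)).toReal))) ∂Pr)
    (hlap : ∫⁻ ω in {ω | F (fun t ↦ B t ω) < ∞}, ENNReal.ofReal
      (Real.exp (-m.rTilde * (F (fun t ↦ B t ω)).toReal)) ∂Pr = ENNReal.ofReal ρ) (K : ℝ) :
    Integrable (discountedGain m B τ₀ K x τ) Pr ∧
      eNPV Pr m B τ₀ K x τ = (m.beta1 * b - K) * ρ := by
  have hE : (Pr.map τ₀).map (fun t : ℝ≥0 ↦ (t : ℝ)) = expMeasure m.lam := by
    rw [Measure.map_map (by fun_prop) hτm]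
    exact hτlaw.map_eq
  set S : Set ((ℝ≥0 → ℝ) × ℝ≥0) := {p | F p.1 < p.2} with hSdef
  have hS : MeasurableSet S := measurableSet_lt (hF.comp measurable_fst) (by fun_prop)
  have hFB : Measurable fun ω ↦ F (fun t ↦ B t ω) := hF.comp (measurable_path hBm)
  have hFp : Measurable fun p : (ℝ≥0 → ℝ) × ℝ≥0 ↦ (F p.1).toReal :=
    (hF.comp measurable_fst).ennreal_toReal
  have hpe := measurable_pathEval
  -- The gain is `β Ψ₁ - K Ψ₂` with nonnegative parts, so `K` may have any sign. `Ψ₃` is `Ψ₁` with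
  -- the wage replaced by its expected growth from `b` at drift `μ`.
  set Ψ₁ : (ℝ≥0 → ℝ) × ℝ≥0 → ℝ≥0∞ := S.indicator fun p ↦ ENNReal.ofReal (Real.exp (-m.r * p.2) *
    (x * Real.exp ((m.μ - m.σ ^ 2 / 2) * p.2 + m.σ * pathEval p.1 p.2)))
  have hΨ₁ : Measurable Ψ₁ := Measurable.indicator (by fun_prop) hS
  set Ψ₂ : (ℝ≥0 → ℝ) × ℝ≥0 → ℝ≥0∞ := S.indicator fun p ↦ ENNReal.ofReal
    (Real.exp (-m.r * (F p.1).toReal))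
  have hΨ₂ : Measurable Ψ₂ := Measurable.indicator (by fun_prop) hS
  set Ψ₃ : (ℝ≥0 → ℝ) × ℝ≥0 → ℝ≥0∞ := S.indicator fun p ↦ ENNReal.ofReal (Real.exp (-m.r * p.2) *
    (b * Real.exp (m.μ * (p.2 - (F p.1).toReal))))
  have hΨ₃ : Measurable Ψ₃ := Measurable.indicator (by fun_prop) hS
  have hslice : ∀ (g : (ℝ≥0 → ℝ) × ℝ≥0 → ℝ≥0∞) (t : ℝ≥0),
      ∫⁻ ω, S.indicator g (fun t ↦ B t ω, t) ∂Pr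
        = ∫⁻ ω in {ω | F (fun t ↦ B t ω) < t}, g (fun t ↦ B t ω, t) ∂Pr := by
    intro g t
    rw [← lintegral_indicator (measurableSet_lt hFB measurable_const)]
    rfl
  have hfibre : ∀ (g : (ℝ≥0 → ℝ) × ℝ≥0 → ℝ≥0∞) (h : ℝ≥0 → ℝ≥0∞),
      (∀ (w : ℝ≥0 → ℝ) (s : ℝ≥0), F w = s → ∫⁻ t in Ioi s, g (w, t) ∂(Pr.map τ₀) = h s) →
      ∫⁻ ω, ∫⁻ t, S.indicator g (fun t ↦ B t ω, t) ∂(Pr.map τ₀) ∂Pr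
        = ∫⁻ ω in {ω | F (fun t ↦ B t ω) < ∞}, h (F (fun t ↦ B t ω)).toNNReal ∂Pr := by
    intro g h hgh
    rw [← lintegral_indicator (measurableSet_lt hFB measurable_const)]
    refine lintegral_congr fun ω ↦ ?_
    by_cases hω : F (fun t ↦ B t ω) < ∞
    · rw [indicator_of_mem (by exact hω), ← hgh _ _ (ENNReal.coe_toNNReal hω.ne).symm,
        ← lintegral_indicator measurableSet_Ioi]
      refine lintegral_congr fun t ↦ ?_
      have : (F (fun t ↦ B t ω)).toNNReal < t ↔ F (fun t ↦ B t ω) < t := by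
        conv_rhs => rw [← ENNReal.coe_toNNReal hω.ne]
        exact ENNReal.coe_lt_coe.symm
      simp only [indicator, mem_Ioi, this, hSdef, mem_ofPred_eq]
    · rw [indicator_of_notMem (by exact hω)]
      simp only [not_lt_top_iff] at hω
      simp [indicator, hSdef, hω]
  have hI₁ : ∫⁻ ω, Ψ₁ (fun t ↦ B t ω, τ₀ ω) ∂Pr
      = ENNReal.ofReal (b * (m.lam / (m.rTilde - m.μ)) * ρ) := by
    -- With the job-loss time frozen at `t`, this is exactly the stopping identity `hwage`.
    have h13 : ∫⁻ ω, Ψ₁ (fun t ↦ B t ω, τ₀ ω) ∂Pr = ∫⁻ ω, Ψ₃ (fun t ↦ B t ω, τ₀ ω) ∂Pr := by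
      rw [lintegral_path_time_symm hBm hτm hind hΨ₁, lintegral_path_time_symm hBm hτm hind hΨ₃]
      refine lintegral_congr fun t ↦ ?_
      rw [hslice, hslice]
      simp_rw [ENNReal.ofReal_mul (Real.exp_nonneg _)]
      rw [lintegral_const_mul' _ _ ENNReal.ofReal_ne_top, lintegral_const_mul' _ _ ENNReal.ofReal_ne_top,
        ← hwage t]
      congr 1
      refine lintegral_congr_ae (ae_restrict_of_ae ?_)
      filter_upwards [hB.cont] with ω hω
      rw [pathEval_eq hω, wage]
    rw [h13, lintegral_path_time hBm hτm hind hΨ₃,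
      hfibre _ (fun s ↦ ENNReal.ofReal (b * (m.lam / (m.rTilde - m.μ))) *
        ENNReal.ofReal (Real.exp (-m.rTilde * s)))]
    · rw [lintegral_const_mul' _ _ ENNReal.ofReal_ne_top]
      simp_rw [ENNReal.coe_toNNReal_eq_toReal]
      rw [hlap, ← ENNReal.ofReal_mul]
      have : 0 < m.rTilde - m.μ := by linarith
      positivity
    · intro w s hs
      have hd : m.lam + (m.r - m.μ) = m.rTilde - m.μ := by rw [Params.rTilde]; ring
      have hg : ∀ t : ℝ≥0, ENNReal.ofReal (Real.exp (-m.r * t) *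
          (b * Real.exp (m.μ * (t - (F w).toReal)))) = ENNReal.ofReal (b * Real.exp (-m.μ * s)) *
            ENNReal.ofReal (Real.exp (-(m.r - m.μ) * t)) := by
        intro t
        rw [← ENNReal.ofReal_mul (by positivity), hs, ENNReal.coe_toReal, mul_left_comm, mul_assoc,
          ← Real.exp_add, ← Real.exp_add]
        congr 3
        ring
      dsimp only
      simp_rw [hg]
      rw [lintegral_const_mul' _ _ ENNReal.ofReal_ne_top,
        lintegral_exp_tail hlam hE (by rw [hd]; linarith), hd, ← ENNReal.ofReal_mul (by positivity),
        ← ENNReal.ofReal_mul (mul_nonneg hb (div_nonneg hlam.le (by linarith)))]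
      congr 1
      rw [show -m.rTilde * (s : ℝ) = -m.μ * s + -(m.rTilde - m.μ) * s by ring, Real.exp_add]
      ring
  have hI₂ : ∫⁻ ω, Ψ₂ (fun t ↦ B t ω, τ₀ ω) ∂Pr = ENNReal.ofReal ρ := by
    rw [lintegral_path_time hBm hτm hind hΨ₂,
      hfibre _ (fun s ↦ ENNReal.ofReal (Real.exp (-m.rTilde * s)))]
    · simp_rw [ENNReal.coe_toNNReal_eq_toReal]
      exact hlap
    · intro w s hs
      have ht := lintegral_exp_tail (δ := 0) hlam hE (by linarith) s
      simp only [neg_zero, zero_mul, Real.exp_zero, ENNReal.ofReal_one, add_zero,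
        div_self hlam.ne', one_mul] at ht
      dsimp only
      rw [hs, ENNReal.coe_toReal, setLIntegral_const, ← setLIntegral_one, ht,
        ← ENNReal.ofReal_mul (by positivity), ← Real.exp_add, Params.rTilde]
      congr 2
      ring
  have hm₁ : Measurable fun ω ↦ Ψ₁ (fun t ↦ B t ω, τ₀ ω) :=
    hΨ₁.comp ((measurable_path hBm).prodMk hτm)
  have hm₂ : Measurable fun ω ↦ Ψ₂ (fun t ↦ B t ω, τ₀ ω) :=
    hΨ₂.comp ((measurable_path hBm).prodMk hτm)
  have hD : discountedGain m B τ₀ K x τ =ᵐ[Pr] fun ω ↦ m.β * (Ψ₁ (fun t ↦ B t ω, τ₀ ω)).toReal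
      - K * (Ψ₂ (fun t ↦ B t ω, τ₀ ω)).toReal := by
    filter_upwards [hτF, hB.cont] with ω hω hc
    rw [discountedGain, hω]
    by_cases h : F (fun t ↦ B t ω) < τ₀ ω
    · have hmem : ((fun t ↦ B t ω, τ₀ ω) : (ℝ≥0 → ℝ) × ℝ≥0) ∈ S := h
      simp only [Ψ₁, Ψ₂, indicator_of_mem hmem]
      rw [if_pos (by exact h), ENNReal.toReal_ofReal (by positivity),
        ENNReal.toReal_ofReal (by positivity), pathEval_eq hc, wage]
      change Real.exp (-m.r * (F (fun t ↦ B t ω)).toReal) *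
        (Real.exp (-m.r * (τ₀ ω - (F (fun t ↦ B t ω)).toReal)) * _ * _ - K) = _
      have he : Real.exp (-m.r * (τ₀ ω : ℝ)) = Real.exp (-m.r * (F (fun t ↦ B t ω)).toReal)
          * Real.exp (-m.r * (τ₀ ω - (F (fun t ↦ B t ω)).toReal)) := by
        rw [← Real.exp_add]
        congr 1
        ring
      rw [he]
      ring
    · have hmem : ((fun t ↦ B t ω, τ₀ ω) : (ℝ≥0 → ℝ) × ℝ≥0) ∉ S := h
      rw [if_neg (by exact h)]
      simp [Ψ₁, Ψ₂, indicator_of_notMem hmem]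
  have hint₁ := integrable_toReal_of_lintegral_ne_top hm₁.aemeasurable
    (by rw [hI₁]; exact ENNReal.ofReal_ne_top)
  have hint₂ := integrable_toReal_of_lintegral_ne_top hm₂.aemeasurable
    (by rw [hI₂]; exact ENNReal.ofReal_ne_top)
  have hfin₁ := ae_lt_top hm₁ (by rw [hI₁]; exact ENNReal.ofReal_ne_top)
  have hfin₂ := ae_lt_top hm₂ (by rw [hI₂]; exact ENNReal.ofReal_ne_top)
  refine ⟨((hint₁.const_mul m.β).sub (hint₂.const_mul K)).congr hD.symm, ?_⟩
  rw [eNPV, integral_congr_ae hD, integral_sub (hint₁.const_mul _) (hint₂.const_mul _),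
    integral_const_mul, integral_const_mul, integral_toReal hm₁.aemeasurable hfin₁,
    integral_toReal hm₂.aemeasurable hfin₂, hI₁, hI₂, ENNReal.toReal_ofReal hρ,
    ENNReal.toReal_ofReal (mul_nonneg (mul_nonneg hb (div_nonneg hlam.le (by linarith))) hρ),
    Params.beta1]
  ring

end Model

/-! ### The exponent and the coefficient -/

section Parameters

variable {m : Params}

lemma qStar_root (hσ : 0 < m.σ) (hr : 0 < m.rTilde) :
    m.σ ^ 2 / 2 * m.qStar ^ 2 + (m.μ - m.σ ^ 2 / 2) * m.qStar = m.rTilde := by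
  have hs : Real.sqrt ((m.μ - m.σ ^ 2 / 2) ^ 2 + 2 * m.rTilde * m.σ ^ 2) ^ 2
      = (m.μ - m.σ ^ 2 / 2) ^ 2 + 2 * m.rTilde * m.σ ^ 2 := Real.sq_sqrt (by positivity)
  rw [Params.qStar]
  set S := Real.sqrt ((m.μ - m.σ ^ 2 / 2) ^ 2 + 2 * m.rTilde * m.σ ^ 2)
  field_simp
  nlinarith

lemma qStar_pos (hσ : 0 < m.σ) (hr : 0 < m.rTilde) : 0 < m.qStar := by
  rw [Params.qStar]
  refine mul_pos (by positivity) ?_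
  have h : |m.μ - m.σ ^ 2 / 2| < Real.sqrt ((m.μ - m.σ ^ 2 / 2) ^ 2 + 2 * m.rTilde * m.σ ^ 2) := by
    rw [Real.lt_sqrt (abs_nonneg _), sq_abs]
    have : 0 < 2 * m.rTilde * m.σ ^ 2 := by positivity
    linarith
  linarith [le_abs_self (m.μ - m.σ ^ 2 / 2)]

/-- The quadratic whose positive root is `q_*` takes at `1` the value `μ < r̃`. In detail, `q_* ≤ 1`
would force `r̃ ≤ μ q_*`. -/
lemma one_lt_qStar (hσ : 0 < m.σ) (hr : 0 < m.rTilde) (hμ : m.μ < m.rTilde) : 1 < m.qStar := by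
  by_contra! h
  have h0 := qStar_pos hσ hr
  have hroot := qStar_root hσ hr
  have h1 : m.σ ^ 2 / 2 * (m.qStar * (1 - m.qStar)) ≥ 0 := by
    have : 0 ≤ 1 - m.qStar := by linarith
    positivity
  have h2 : m.rTilde ≤ m.μ * m.qStar := by nlinarith
  rcases le_or_gt m.μ 0 with h3 | h3
  · nlinarith [mul_nonneg (neg_nonneg.2 h3) h0.le]
  · nlinarith

lemma beta1_pos (hlam : 0 < m.lam) (hβ : 0 < m.β) (hμ : m.μ < m.rTilde) : 0 < m.beta1 := by
  have : 0 < m.rTilde - m.μ := by linarith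
  rw [Params.beta1]
  positivity

end Parameters

/-! ### Deterministic optimisation over thresholds -/

section Threshold

variable {β q K : ℝ}

lemma one_add_mul_sub_one_le_rpow (hq : 1 < q) {z : ℝ} (hz : 0 ≤ z) : 1 + q * (z - 1) ≤ z ^ q := by
  simpa using one_add_mul_self_le_rpow_one_add (s := z - 1) (by linarith) hq.le

lemma one_add_mul_sub_one_lt_rpow (hq : 1 < q) {z : ℝ} (hz : 0 ≤ z) (hz1 : z ≠ 1) :
    1 + q * (z - 1) < z ^ q := by
  simpa using one_add_mul_self_lt_rpow_one_add (s := z - 1) (by linarith) (sub_ne_zero.2 hz1) hq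

lemma threshold_sub (hβ : 0 < β) (hq : 1 < q) :
    β * (K * q / (β * (q - 1))) - K = K / (q - 1) := by
  have : q - 1 ≠ 0 := by linarith
  field_simp
  ring

/-- The gain from an optimal threshold strictly dominates every other threshold. -/
lemma gain_lt_gain_threshold (hβ : 0 < β) (hq : 1 < q) (hK : 0 < K) {x b : ℝ} (hx : 0 < x)
    (hb : 0 < b) (hne : b ≠ K * q / (β * (q - 1))) :
    (β * b - K) * (x / b) ^ q
      < (β * (K * q / (β * (q - 1))) - K) * (x / (K * q / (β * (q - 1)))) ^ q := by
  have hq1 : 0 < q - 1 := by linarith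
  set d := K * q / (β * (q - 1)) with hd
  have hdpos : 0 < d := by positivity
  have hdb : β * d = K * q / (q - 1) := by rw [hd]; field_simp
  have hz : b / d ≠ 1 := fun h ↦ hne ((div_eq_one_iff_eq hdpos.ne').1 h)
  have hbern := one_add_mul_sub_one_lt_rpow hq (by positivity : 0 ≤ b / d) hz
  -- With `z = b/d`, the ratio of the gain at `b` to the gain at `d` is `(1 + q(z - 1)) / z^q`.
  have hβb : β * b - K = K / (q - 1) * (1 + q * (b / d - 1)) := by
    have : β * b = β * d * (b / d) := by field_simp
    rw [this, hdb]
    field_simp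
    ring
  have hxb : (x / d) ^ q = (x / b) ^ q * (b / d) ^ q := by
    rw [← Real.mul_rpow (by positivity) (by positivity)]
    congr 1
    field_simp
  rw [threshold_sub hβ hq, hβb, hxb]
  have hpos : 0 < K / (q - 1) * (x / b) ^ q := by positivity
  nlinarith [mul_lt_mul_of_pos_left hbern hpos]

/-- Above the optimal threshold, stopping immediately is optimal. -/
lemma gain_le_immediate (hβ : 0 < β) (hq : 1 < q) {x b : ℝ} (hx : 0 < x)
    (hxb : x ≤ b) (hd : K * q / (β * (q - 1)) ≤ x) :
    (β * b - K) * (x / b) ^ q ≤ β * x - K := by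
  have hq1 : 0 < q - 1 := by linarith
  have hb : 0 < b := hx.trans_le hxb
  have hz1 : 1 ≤ b / x := (one_le_div hx).2 hxb
  have hbern := one_add_mul_sub_one_le_rpow hq (by linarith : 0 ≤ b / x)
  have hd' : K * q ≤ β * x * (q - 1) := by
    rw [div_le_iff₀ (by positivity)] at hd
    linarith
  have hinv : (x / b) ^ q = ((b / x) ^ q)⁻¹ := by
    rw [← Real.inv_rpow (by positivity), inv_div]
  have hzq : 0 < (b / x) ^ q := by positivity
  rw [hinv, mul_inv_le_iff₀ hzq]
  have hbz : β * b = β * x * (b / x) := by field_simp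
  rw [hbz]
  set z := b / x
  set w := z ^ q
  have hw1 : 1 ≤ w := by nlinarith
  -- The factor `q` splits the difference into a Bernoulli term and a term whose sign is the
  -- hypothesis that `x` is above the threshold; no sign of `K` is needed.
  have key : q * (β * x * (w - z) - K * (w - 1)) ≥ 0 := by
    have e : q * (β * x * (w - z) - K * (w - 1)) = β * x * (w - (1 + q * (z - 1)))
        + (β * x * (q - 1) - K * q) * (w - 1) := by ring
    rw [e]
    have h1 := mul_nonneg (mul_pos hβ hx).le (sub_nonneg.2 hbern)
    have h2 := mul_nonneg (sub_nonneg.2 hd') (sub_nonneg.2 hw1)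
    linarith
  have := nonneg_of_mul_nonneg_right key (by linarith : 0 < q)
  linarith

end Threshold

lemma ennreal_eq_of_forall_lt_iff {a b : ℝ≥0∞} (h : ∀ s : ℝ≥0, a < s ↔ b < s) : a = b := by
  apply le_antisymm <;> by_contra! hlt <;>
    obtain ⟨s, h1, h2⟩ := ENNReal.lt_iff_exists_nnreal_btwn.1 hlt
  · exact h2.not_gt ((h s).2 h1)
  · exact h2.not_gt ((h s).1 h1)

/-! ### From the wage to Brownian motion -/

section HitTime

variable {Ω : Type*} {B : ℝ≥0 → Ω → ℝ} {m : Params} {x b : ℝ} {ω : Ω}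

lemma hitTime_of_le (h0 : B 0 ω = 0) (hb : b ≤ x) : hitTime m B x b ω = 0 := by
  refine le_antisymm (hittingAfter_le_of_mem le_rfl ?_) (le_hittingAfter ω)
  simpa [wage, h0] using hb

lemma hitTime_zero_of_pos (hb : 0 < b) : hitTime m B 0 b ω = ⊤ := by
  rw [hitTime, hittingAfter_eq_top_iff]
  intro t _
  simpa [wage] using hb

lemma le_wage_iff (hσ : 0 < m.σ) (hx : 0 < x) (hb : 0 < b) (t : ℝ≥0) :
    b ≤ wage m B x t ω ↔
      Real.log (b / x) / m.σ + -(m.μ - m.σ ^ 2 / 2) / m.σ * t ≤ B t ω := by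
  rw [wage, ← div_le_iff₀' hx, ← Real.log_le_iff_le_exp (by positivity), div_mul_eq_mul_div,
    ← add_div, div_le_iff₀ hσ]
  constructor <;> intro h <;> linarith

lemma hitTime_eq_lineHit (hσ : 0 < m.σ) (hx : 0 < x) (hb : 0 < b)
    (hω : Continuous fun t ↦ B t ω) :
    hitTime m B x b ω = lineHit (Real.log (b / x) / m.σ) (-(m.μ - m.σ ^ 2 / 2) / m.σ)
      (fun t ↦ B t ω) := by
  refine ennreal_eq_of_forall_lt_iff fun s ↦ ?_
  rw [lineHit_lt_iff hω]
  refine hittingAfter_lt_iff.trans ?_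
  simp only [mem_Ico, zero_le, true_and, mem_Ici, le_wage_iff hσ hx hb]

/-- Puts the wage into the martingale family, with parameter `c = σ`. -/
lemma ofReal_wage (hx : 0 ≤ x) (t : ℝ≥0) :
    ENNReal.ofReal (wage m B x t ω)
      = ENNReal.ofReal (x * Real.exp (m.μ * t)) * expMart B m.σ t ω := by
  rw [expMart, ← ENNReal.ofReal_mul (by positivity), wage, mul_assoc, ← Real.exp_add]
  congr 3
  ring

lemma hitProb_zero [MeasurableSpace Ω] {Pr : Measure Ω} (hb : 0 < b) : hitProb Pr m B 0 b = 0 := by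
  simp [hitProb, hitTime_zero_of_pos hb]

end HitTime

/-! ### Closed forms of the objectives -/

section Values

variable {Ω : Type*} [MeasurableSpace Ω] {Pr : Measure Ω} [IsProbabilityMeasure Pr] {m : Params}
  {B : ℝ≥0 → Ω → ℝ} {τ₀ : Ω → ℝ≥0} {x b : ℝ}

lemma hitProb_of_le (hB : IsBrownianReal B Pr) (hbx : b ≤ x) : hitProb Pr m B x b = 1 := by
  have : ∀ᵐ ω ∂Pr, hitTime m B x b ω < ⊤ := by
    filter_upwards [hB.eval_zero_ae_eq_zero] with ω h0
    rw [hitTime_of_le h0 hbx]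
    exact WithTop.coe_lt_top 0
  rw [hitProb, measureReal_def, measure_congr (eventuallyEq_univ.2 this), measure_univ,
    ENNReal.toReal_one]

/-- Probability that the wage ever reaches a higher level. -/
lemma hitProb_of_lt (hσ : 0 < m.σ) (hμσ : m.μ < m.σ ^ 2 / 2) (hBm : ∀ t, Measurable (B t))
    (hB : IsBrownianReal B Pr) (hx : 0 < x) (hxb : x < b) :
    hitProb Pr m B x b = (x / b) ^ (1 - 2 * m.μ / m.σ ^ 2) := by
  have hb : 0 < b := hx.trans hxb
  have hα : 0 < Real.log (b / x) / m.σ := div_pos (Real.log_pos ((one_lt_div hx).2 hxb)) hσ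
  have hγ : 0 < -(m.μ - m.σ ^ 2 / 2) / m.σ := div_pos (by linarith) hσ
  have hae : {ω | hitTime m B x b ω < ⊤} =ᵐ[Pr] {ω | lineHit (Real.log (b / x) / m.σ)
      (-(m.μ - m.σ ^ 2 / 2) / m.σ) (fun t ↦ B t ω) < ∞} := by
    filter_upwards [hB.cont] with ω hω
    have := hitTime_eq_lineHit (m := m) hσ hx hb hω
    apply propext
    change hitTime m B x b ω < ⊤ ↔ _
    rw [this]
    rfl
  rw [hitProb, measureReal_def, measure_congr hae, measure_lineHit_lt_top hBm hB hα hγ,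
    ENNReal.toReal_ofReal (by positivity), Real.rpow_def_of_pos (by positivity),
    ← inv_div b x, Real.log_inv]
  congr 1
  field_simp
  ring

/-- A threshold below the starting point means immediate entry. -/
lemma eNPV_of_le (hlam : 0 < m.lam) (hμ : m.μ < m.rTilde) (hBm : ∀ t, Measurable (B t))
    (hB : IsBrownianReal B Pr) (hτm : Measurable τ₀)
    (hτlaw : HasLaw (fun ω ↦ (τ₀ ω : ℝ)) (expMeasure m.lam) Pr)
    (hind : IndepFun (fun ω t ↦ B t ω) τ₀ Pr) (hx : 0 ≤ x) (hbx : b ≤ x) (K : ℝ) :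
    Integrable (discountedGain m B τ₀ K x (hitTime m B x b)) Pr ∧
      eNPV Pr m B τ₀ K x (hitTime m B x b) = m.beta1 * x - K := by
  -- Immediate entry: the time is the functional `0`, the level is `x` and the Laplace transform is
  -- `1`.
  have := integrable_discountedGain_and_eNPV_eq hlam hμ hBm hB hτm hτlaw hind hx hx zero_le_one
    (τ := hitTime m B x b) (F := fun _ ↦ 0) measurable_const ?_ ?_ ?_ K
  · simpa using this
  · filter_upwards [hB.eval_zero_ae_eq_zero] with ω h0
    rw [hitTime_of_le h0 hbx]
    rfl
  · intro t
    rcases eq_or_ne t 0 with rfl | ht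
    · simp
    · have hset : {ω : Ω | (0 : ℝ≥0∞) < t} = univ := by
        ext ω
        simpa using pos_iff_ne_zero.2 ht
      simp_rw [ofReal_wage hx]
      rw [hset, Measure.restrict_univ, lintegral_const_mul _ (measurable_expMart hBm _ _),
        lintegral_expMart hB.toIsPreBrownianReal]
      simp
  · simp

/-- Expected net present value of a threshold above the starting point. -/
lemma eNPV_of_lt (hlam : 0 < m.lam) (hμ : m.μ < m.rTilde) (hBm : ∀ t, Measurable (B t))
    (hB : IsBrownianReal B Pr) (hτm : Measurable τ₀)
    (hτlaw : HasLaw (fun ω ↦ (τ₀ ω : ℝ)) (expMeasure m.lam) Pr)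
    (hind : IndepFun (fun ω t ↦ B t ω) τ₀ Pr) (hσ : 0 < m.σ) (hr : 0 < m.rTilde)
    (hx : 0 ≤ x) (hxb : x < b) (K : ℝ) :
    Integrable (discountedGain m B τ₀ K x (hitTime m B x b)) Pr ∧
      eNPV Pr m B τ₀ K x (hitTime m B x b) = (m.beta1 * b - K) * (x / b) ^ m.qStar := by
  have hb : 0 < b := hx.trans_lt hxb
  have hq := qStar_pos hσ hr
  rcases hx.eq_or_lt with rfl | hx
  -- A zero wage never reaches `b > 0`: the time is `∞`, and both sides vanish since `0 ^ q_* = 0`.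
  · refine integrable_discountedGain_and_eNPV_eq hlam hμ hBm hB hτm hτlaw hind le_rfl hb.le
      (by positivity) (F := fun _ ↦ ∞) measurable_const ?_ ?_ ?_ K
    · refine .of_forall fun ω ↦ ?_
      rw [hitTime_zero_of_pos hb]
      rfl
    · simp
    · simp [Real.zero_rpow hq.ne']
  have hα : 0 < Real.log (b / x) / m.σ := div_pos (Real.log_pos ((one_lt_div hx).2 hxb)) hσ
  have hroot := qStar_root hσ hr
  refine integrable_discountedGain_and_eNPV_eq hlam hμ hBm hB hτm hτlaw hind hx.le hb.le
    (by positivity) (measurable_lineHit (Real.log (b / x) / m.σ) (-(m.μ - m.σ ^ 2 / 2) / m.σ))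
    ?_ ?_ ?_ K
  · filter_upwards [hB.cont] with ω hω using hitTime_eq_lineHit hσ hx hb hω
  · intro t
    rcases eq_or_ne t 0 with rfl | ht
    · simp
    simp_rw [ofReal_wage hx.le]
    rw [lintegral_const_mul' _ _ ENNReal.ofReal_ne_top,
      setLIntegral_expMart_lineHit hBm hB hα _ _ (pos_iff_ne_zero.2 ht),
      ← lintegral_const_mul' _ _ ENNReal.ofReal_ne_top]
    refine lintegral_congr fun ω ↦ ?_
    have hbx : b = x * Real.exp (Real.log (b / x)) := by
      rw [Real.exp_log (by positivity)]
      field_simp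
    rw [← ENNReal.ofReal_mul (by positivity)]
    generalize (lineHit (Real.log (b / x) / m.σ) _ fun t ↦ B t ω).toReal = T
    conv_rhs => rw [hbx]
    rw [mul_assoc, mul_assoc, ← Real.exp_add, ← Real.exp_add]
    congr 3
    field_simp
    ring
  -- If `2γ ≤ σ q_*` failed, the quadratic would be negative at `q_*`, whereas it equals `r̃ > 0`
  -- there.
  · have hlap := lintegral_exp_lineHit (γ := -(m.μ - m.σ ^ 2 / 2) / m.σ) (c := m.σ * m.qStar)
      hBm hB hα (by positivity) (by
        rw [← mul_div_assoc, div_le_iff₀ hσ]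
        by_contra! h
        nlinarith [mul_lt_mul_of_pos_right h hq])
    have hs : (m.σ * m.qStar) ^ 2 / 2 - m.σ * m.qStar * (-(m.μ - m.σ ^ 2 / 2) / m.σ)
        = m.rTilde := by
      rw [← hroot]
      field_simp
      ring
    rw [hs] at hlap
    rw [hlap, Real.rpow_def_of_pos (by positivity), ← inv_div b x, Real.log_inv]
    congr 2
    field_simp

lemma utilityObjective_of_le (hlam : 0 < m.lam) (hμ : m.μ < m.rTilde) (hBm : ∀ t, Measurable (B t))
    (hB : IsBrownianReal B Pr) (hτm : Measurable τ₀)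
    (hτlaw : HasLaw (fun ω ↦ (τ₀ ω : ℝ)) (expMeasure m.lam) Pr)
    (hind : IndepFun (fun ω t ↦ B t ω) τ₀ Pr) (hx : 0 ≤ x) (hbx : b ≤ x) (P κ : ℝ) :
    utilityObjective Pr m B τ₀ P κ x b = m.beta1 * x + κ - P := by
  rw [utilityObjective, hitProb_of_le hB hbx,
    (eNPV_of_le hlam hμ hBm hB hτm hτlaw hind hx hbx P).2, Real.one_rpow]
  ring

lemma utilityObjective_of_lt (hlam : 0 < m.lam) (hμ : m.μ < m.rTilde) (hBm : ∀ t, Measurable (B t))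
    (hB : IsBrownianReal B Pr) (hτm : Measurable τ₀)
    (hτlaw : HasLaw (fun ω ↦ (τ₀ ω : ℝ)) (expMeasure m.lam) Pr)
    (hind : IndepFun (fun ω t ↦ B t ω) τ₀ Pr) (hσ : 0 < m.σ) (hr : 0 < m.rTilde) (hμσ : m.μ < m.σ ^ 2 / 2)
    (hx : 0 ≤ x) (hxb : x < b) (P κ : ℝ) :
    utilityObjective Pr m B τ₀ P κ x b = (m.beta1 * b + κ - P) * (x / b) ^ m.qStar := by
  have hb : 0 < b := hx.trans_lt hxb
  have hθ : 0 < 1 - 2 * m.μ / m.σ ^ 2 := by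
    rw [sub_pos, div_lt_one (by positivity)]
    linarith
  have hprob : hitProb Pr m B x b ^ (m.qStar / (1 - 2 * m.μ / m.σ ^ 2)) = (x / b) ^ m.qStar := by
    rcases hx.eq_or_lt with rfl | hx
    · have hq := qStar_pos hσ hr
      rw [hitProb_zero hb, zero_div, Real.zero_rpow (by positivity), Real.zero_rpow hq.ne']
    · rw [hitProb_of_lt hσ hμσ hBm hB hx hxb, ← Real.rpow_mul (by positivity),
        mul_div_cancel₀ _ hθ.ne']
  rw [utilityObjective, hprob,
    (eNPV_of_lt hlam hμ hBm hB hτm hτlaw hind hσ hr hx hxb P).2]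
  ring

end Values

end UnemploymentInsurance

/-! ### The utility problem -/

theorem mainTheorem8 {Ω : Type*} [MeasurableSpace Ω] (Pr : Measure Ω) [IsProbabilityMeasure Pr]
    (m : UnemploymentInsurance.Params)
    (hσ : 0 < m.σ) (hlam : 0 < m.lam) (hr : 0 < m.r + m.lam) (hβ : 0 < m.β)
    (hμ : m.μ < m.r + m.lam) (hμσ : m.μ < m.σ ^ 2 / 2)
    -- standard Brownian motion driving the wage
    (B : ℝ≥0 → Ω → ℝ) (hBm : ∀ t, Measurable (B t)) (hB : IsBrownianReal B Pr)
    -- time of losing the job: exponential and independent of the wage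
    (τ₀ : Ω → ℝ≥0) (hτm : Measurable τ₀)
    (hτlaw : HasLaw (fun ω ↦ (τ₀ ω : ℝ)) (expMeasure m.lam) Pr)
    (hind : IndepFun (fun ω t ↦ B t ω) τ₀ Pr)
    (P κ : ℝ) (hP : 0 < P) (hκ : 0 ≤ κ) :
    -- the threshold
    1 < m.qStar ∧ 0 < m.beta1 ∧
    m.bDag P κ = m.bStar P - κ * m.qStar / (m.beta1 * (m.qStar - 1)) ∧
    m.bDag P κ ≤ m.bStar P ∧
    ∀ x : ℝ, 0 ≤ x →
      -- the expectations exist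
      (∀ K b : ℝ, 0 ≤ b → Integrable (UnemploymentInsurance.discountedGain m B τ₀ K x
        (UnemploymentInsurance.hitTime m B x b)) Pr) ∧
      -- reduction to the original problem with the premium `P - κ`
      (∀ b : ℝ, 0 ≤ b → UnemploymentInsurance.utilityObjective Pr m B τ₀ P κ x b
        = UnemploymentInsurance.eNPV Pr m B τ₀ (P - κ) x
            (UnemploymentInsurance.hitTime m B x b)) ∧
      UnemploymentInsurance.utilityValue Pr m B τ₀ P κ x
        = UnemploymentInsurance.hitValue Pr m B τ₀ (P - κ) x ∧
      (0 < x → UnemploymentInsurance.utilityValue Pr m B τ₀ P κ x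
        = ⨆ b : Set.Ici x,
            (((m.beta1 * (b : ℝ) + κ - P) * (x / (b : ℝ)) ^ m.qStar : ℝ) : EReal)) ∧
      -- optimality of the threshold
      IsMaxOn (UnemploymentInsurance.utilityObjective Pr m B τ₀ P κ x) (Set.Ici 0)
        (m.bDag P κ) ∧
      (m.bDag P κ ≤ x →
        IsMaxOn (UnemploymentInsurance.utilityObjective Pr m B τ₀ P κ x) (Set.Ici 0) x) ∧
      (0 < x → x < m.bDag P κ → ∀ b : ℝ, 0 ≤ b → b ≠ m.bDag P κ →
        UnemploymentInsurance.utilityObjective Pr m B τ₀ P κ x b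
          < UnemploymentInsurance.utilityObjective Pr m B τ₀ P κ x (m.bDag P κ)) ∧
      UnemploymentInsurance.utilityValue Pr m B τ₀ P κ x
        = ((UnemploymentInsurance.utilityObjective Pr m B τ₀ P κ x (m.bDag P κ) : ℝ) : EReal) ∧
      -- the value function
      (κ < P → x ≤ m.bDag P κ →
        UnemploymentInsurance.utilityValue Pr m B τ₀ P κ x
          = (((m.beta1 * m.bDag P κ + κ - P) * (x / m.bDag P κ) ^ m.qStar : ℝ) : EReal) ∧
        UnemploymentInsurance.utilityValue Pr m B τ₀ P κ x
          = (((P - κ) / (m.qStar - 1) *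
              (m.beta1 * (m.qStar - 1) * x / ((P - κ) * m.qStar)) ^ m.qStar : ℝ) : EReal)) ∧
      (m.bDag P κ ≤ x →
        UnemploymentInsurance.utilityValue Pr m B τ₀ P κ x
          = ((m.beta1 * x + κ - P : ℝ) : EReal)) := by
  have hr' : 0 < m.rTilde := hr
  have hμ' : m.μ < m.rTilde := hμ
  have hq := UnemploymentInsurance.one_lt_qStar hσ hr' hμ'
  have hβ1 := UnemploymentInsurance.beta1_pos hlam hβ hμ'
  have hq1 : 0 < m.qStar - 1 := by linarith
  have hdag : m.bDag P κ = m.bStar P - κ * m.qStar / (m.beta1 * (m.qStar - 1)) := by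
    rw [UnemploymentInsurance.Params.bDag, UnemploymentInsurance.Params.bStar]
    ring
  have hDpos : 0 < P - κ → 0 < m.bDag P κ := fun h ↦ by
    rw [UnemploymentInsurance.Params.bDag]
    positivity
  have hDsub : m.beta1 * m.bDag P κ + κ - P = (P - κ) / (m.qStar - 1) := by
    rw [← UnemploymentInsurance.threshold_sub hβ1 hq, UnemploymentInsurance.Params.bDag]
    ring
  have hDK : 0 < m.bDag P κ → 0 < P - κ := fun h ↦ by
    by_contra! hK
    rw [UnemploymentInsurance.Params.bDag] at h
    exact h.not_ge (div_nonpos_of_nonpos_of_nonneg (mul_nonpos_of_nonpos_of_nonneg hK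
      (by linarith)) (by positivity))
  refine ⟨hq, hβ1, hdag, ?_, fun x hx ↦ ?_⟩
  · rw [hdag]
    have : 0 ≤ κ * m.qStar / (m.beta1 * (m.qStar - 1)) := by positivity
    linarith
  have hJle : ∀ b ≤ x, UnemploymentInsurance.utilityObjective Pr m B τ₀ P κ x b
      = m.beta1 * x + κ - P := fun b hb ↦
    UnemploymentInsurance.utilityObjective_of_le hlam hμ' hBm hB hτm hτlaw hind hx hb P κ
  have hJlt : ∀ b, x < b → UnemploymentInsurance.utilityObjective Pr m B τ₀ P κ x b
      = (m.beta1 * b + κ - P) * (x / b) ^ m.qStar := fun b hb ↦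
    UnemploymentInsurance.utilityObjective_of_lt hlam hμ' hBm hB hτm hτlaw hind hσ hr' hμσ hx hb P κ
  have hJge : 0 < x → ∀ b, x ≤ b → UnemploymentInsurance.utilityObjective Pr m B τ₀ P κ x b
      = (m.beta1 * b + κ - P) * (x / b) ^ m.qStar := fun hx0 b hb ↦ by
    rcases hb.eq_or_lt with rfl | hb
    · rw [hJle x le_rfl, div_self hx0.ne', Real.one_rpow, mul_one]
    · exact hJlt b hb
  have hred : ∀ b : ℝ, UnemploymentInsurance.utilityObjective Pr m B τ₀ P κ x b
      = UnemploymentInsurance.eNPV Pr m B τ₀ (P - κ) x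
          (UnemploymentInsurance.hitTime m B x b) := fun b ↦ by
    rcases le_or_gt b x with hb | hb
    · rw [hJle b hb, (UnemploymentInsurance.eNPV_of_le hlam hμ' hBm hB hτm hτlaw hind hx hb _).2]
      ring
    · rw [hJlt b hb,
        (UnemploymentInsurance.eNPV_of_lt hlam hμ' hBm hB hτm hτlaw hind hσ hr' hx hb _).2]
      ring
  have hstrict : 0 < x → x < m.bDag P κ → ∀ b : ℝ, b ≠ m.bDag P κ →
      UnemploymentInsurance.utilityObjective Pr m B τ₀ P κ x b
        < UnemploymentInsurance.utilityObjective Pr m B τ₀ P κ x (m.bDag P κ) := by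
    intro hx0 hxD
    have hK := hDK (hx0.trans hxD)
    have habove : ∀ b, x ≤ b → b ≠ m.bDag P κ →
        UnemploymentInsurance.utilityObjective Pr m B τ₀ P κ x b
          < UnemploymentInsurance.utilityObjective Pr m B τ₀ P κ x (m.bDag P κ) := by
      intro b hb hne
      have := UnemploymentInsurance.gain_lt_gain_threshold hβ1 hq hK hx0 (hx0.trans_le hb) hne
      rw [hJge hx0 b hb, hJlt _ hxD, UnemploymentInsurance.Params.bDag, add_sub_assoc,
        add_sub_assoc, ← neg_sub P κ, ← sub_eq_add_neg, ← sub_eq_add_neg]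
      exact this
    intro b hne
    rcases le_total x b with hb | hb
    · exact habove b hb hne
    · rw [hJle b hb, ← hJle x le_rfl]
      exact habove x le_rfl hxD.ne
  have himm : m.bDag P κ ≤ x → ∀ b, UnemploymentInsurance.utilityObjective Pr m B τ₀ P κ x b
      ≤ m.beta1 * x + κ - P := by
    intro hDx b
    rcases le_or_gt b x with hb | hb
    · exact (hJle b hb).le
    rw [hJlt b hb]
    rcases hx.eq_or_lt with rfl | hx0
    -- At `x = 0` waiting yields zero, and `b† ≤ 0` means that immediate entry yields `κ - P ≥ 0`.
    · have hK : P - κ ≤ 0 := by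
        by_contra! h
        exact (hDpos h).not_ge hDx
      rw [zero_div, Real.zero_rpow (by linarith)]
      linarith
    · have := UnemploymentInsurance.gain_le_immediate hβ1 hq hx0 hb.le hDx
      rw [add_sub_assoc, add_sub_assoc, ← neg_sub P κ, ← sub_eq_add_neg, ← sub_eq_add_neg]
      exact this
  have hmax : ∀ b, UnemploymentInsurance.utilityObjective Pr m B τ₀ P κ x b
      ≤ UnemploymentInsurance.utilityObjective Pr m B τ₀ P κ x (m.bDag P κ) := by
    intro b
    rcases le_or_gt (m.bDag P κ) x with hDx | hxD
    · rw [hJle _ hDx]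
      exact himm hDx b
    · rcases hx.eq_or_lt with rfl | hx0
      · have hK := hDK hxD
        rw [hJlt _ hxD, zero_div, Real.zero_rpow (by linarith), mul_zero]
        rcases le_or_gt b 0 with hb | hb
        · rw [hJle b hb]
          linarith
        · rw [hJlt b hb, zero_div, Real.zero_rpow (by linarith), mul_zero]
      · rcases eq_or_ne b (m.bDag P κ) with rfl | hne
        · exact le_rfl
        · exact (hstrict hx0 hxD b hne).le
  have hval : UnemploymentInsurance.utilityValue Pr m B τ₀ P κ x
      = ((UnemploymentInsurance.utilityObjective Pr m B τ₀ P κ x (m.bDag P κ) : ℝ) : EReal) := by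
    refine le_antisymm (iSup_le fun b ↦ EReal.coe_le_coe_iff.2 (hmax b)) ?_
    -- The threshold may be negative, hence outside the index set; in the case `b† ≤ x` the witness
    -- is `x`, which has the same value.
    rcases le_or_gt (m.bDag P κ) x with hDx | hxD
    · rw [hJle _ hDx, ← hJle x le_rfl]
      exact le_iSup (fun b : Set.Ici (0 : ℝ) ↦
        ((UnemploymentInsurance.utilityObjective Pr m B τ₀ P κ x b : ℝ) : EReal)) ⟨x, hx⟩
    · exact le_iSup (fun b : Set.Ici (0 : ℝ) ↦
        ((UnemploymentInsurance.utilityObjective Pr m B τ₀ P κ x b : ℝ) : EReal))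
        ⟨m.bDag P κ, hx.trans hxD.le⟩
  refine ⟨fun K b _ ↦ ?_, fun b _ ↦ hred b, ?_, fun hx0 ↦ ?_, fun b _ ↦ hmax b,
    fun hDx b _ ↦ ?_, fun hx0 hxD b _ ↦ hstrict hx0 hxD b, hval, fun hκP hxD ↦ ?_, fun hDx ↦ ?_⟩
  · rcases le_or_gt b x with hb | hb
    · exact (UnemploymentInsurance.eNPV_of_le hlam hμ' hBm hB hτm hτlaw hind hx hb K).1
    · exact (UnemploymentInsurance.eNPV_of_lt hlam hμ' hBm hB hτm hτlaw hind hσ hr' hx hb K).1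
  · simp only [UnemploymentInsurance.utilityValue, UnemploymentInsurance.hitValue, hred]
  · apply le_antisymm
    · refine iSup_le fun b ↦ ?_
      -- All thresholds up to `x` mean immediate entry, so raising `b` to `max b x` does not change
      -- the objective.
      refine le_iSup_of_le ⟨max b x, Set.mem_Ici.2 (le_max_right _ _)⟩ (EReal.coe_le_coe_iff.2 ?_)
      rw [← hJge hx0 _ (le_max_right _ _)]
      rcases le_total (b : ℝ) x with hb | hb
      · rw [max_eq_right hb, hJle b hb, hJle x le_rfl]
      · rw [max_eq_left hb]
    · refine iSup_le fun b ↦ ?_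
      rw [← hJge hx0 b b.2]
      exact le_iSup (fun b : Set.Ici (0 : ℝ) ↦
        ((UnemploymentInsurance.utilityObjective Pr m B τ₀ P κ x b : ℝ) : EReal))
        ⟨b, hx.trans b.2⟩
  · change UnemploymentInsurance.utilityObjective Pr m B τ₀ P κ x b
      ≤ UnemploymentInsurance.utilityObjective Pr m B τ₀ P κ x x
    rw [hJle x le_rfl]
    exact himm hDx b
  · have hK : 0 < P - κ := by linarith
    have hD := hDpos hK
    have hfirst : UnemploymentInsurance.utilityObjective Pr m B τ₀ P κ x (m.bDag P κ)
        = (m.beta1 * m.bDag P κ + κ - P) * (x / m.bDag P κ) ^ m.qStar := by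
      rcases hxD.eq_or_lt with h | h
      · exact hJge (h ▸ hD) _ hxD
      · exact hJlt _ h
    refine ⟨by rw [hval, hfirst], ?_⟩
    rw [hval, hfirst, hDsub, UnemploymentInsurance.Params.bDag, div_div_eq_mul_div,
      mul_comm x]
  · rw [hval, hJle _ hDx]
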